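/- **Setting.** Fix two distinct datasets $D_1\neq D_2$ in a set $\mathcal D$. For probability measures $P,Q$ on a measurable space, $\operatorname{PLD}(P\parallel Q)$ is the law on $\mathbb R\cup\{\infty\}$ of $\log\frac{dP}{dQ}(\omega)$, $\omega\sim P$, where $\frac{dP}{dQ}:=\frac{dP}{d\nu}/\frac{dQ}{d\nu}$ for $\nu=P+Q$ (with $\cdot/0=\infty$). A PLD is a distribution of this form. Write $(P,Q)\preceq(P',Q')$ if there is a Markov kernel $\phi$ with $P=\phi P'$ and $Q=\phi Q'$, and, for PLDs, $L\preceq L'$ if $L=\operatorname{PLD}(P\parallel Q)$ and $L'=\operatorname{PLD}(P'\parallel Q')$ for some $(P,Q)\preceq(P',Q')$. Let $\oplus$ be convolution, $\mathrm{Id}$ the point mass at $0$, and $\sup$ the least upper bound among PLDs with respect to $\preceq$. Let $\mathcal L$ be a family of PLDs with $\mathrm{Id}\in\mathcal L$, and let $\mathcal L^{<k}$ be the set of convolutions $L_1\oplus\cdots\oplus L_m$ with $m<k$ and $L_1,\dots,L_m\in\mathcal L$ (the empty convolution being $\mathrm{Id}$). For a PLD $B$ (the budget) and an integer $k\ge 1$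 (the capacity), the natural filter is *free* if $\operatorname{PLD}(M(D_1)\parallel M(D_2))\preceq B$ for every adaptive composition $M=M_1\otimes\cdots\otimes M_k$ of mechanisms, each of which is for every dataset a Markov kernel from past outcomes to its own outcome space, such that for all outcomes $y_1,y_2,\dots$ and all $1\le i\le k$ the PLDs $$L_i:=\operatorname{PLD}\bigl(M_i(D_1;y_1,\dots,y_{i-1})\parallel M_i(D_2;y_1,\dots,y_{i-1})\bigr)$$ satisfy $L_i\in\mathcal L$ and $L_1\oplus\cdots\oplus L_i\preceq B$. **Theorem.** For each $k\ge1$, the natural filter with capacity $k$ is free for every budget $B$ if and only if, for all $L\in\mathcal L$ and all nonempty $\mathcal L'\subseteq\mathcal L^{<k}$, the supremum of $\mathcal L'$ exists and $$L\oplus\sup\mathcal L'=\sup\{L\oplus L':L'\in\mathcal L'\}.\qquad(\ast)$$ In particular, the natural filter is free for all budgets $B$ and all capacities $k\ge1$ simultaneously if and only if, for every $k\ge 1$, all $L\in\mathcal L$ and all nonempty $\mathcal L'\subseteq\mathcal L^{<k}$, the supremum of $\mathcal L'$ exists and $(\ast)$ holds. -/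

import Mathlib

open MeasureTheory ProbabilityTheory

universe u v

namespace PrivacyLoss

noncomputable section

/-! ### Privacy loss distributions

Distributions on `ℝ ∪ {∞}` are represented as measures on `EReal`. A privacy loss distribution
never charges `⊥`, since the likelihood ratio `dP/dQ` is `P`-almost surely nonzero. -/

/-- The likelihood ratio `dP/dQ`, computed with the dominating measure `P + Q`;
`P` need not be absolutely continuous with respect to `Q`, and `p / 0 = ∞` for `p ≠ 0`. -/
def likelihoodRatio {Ω : Type*} [MeasurableSpace Ω] (P Q : Measure Ω) (ω : Ω) : ENNReal :=
  P.rnDeriv (P + Q) ω / Q.rnDeriv (P + Q) ω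

/-- `PLD(P ‖ Q)`: the law of `log (dP/dQ)(ω)` for `ω ∼ P`. -/
def pld {Ω : Type*} [MeasurableSpace Ω] (P Q : Measure Ω) : Measure EReal :=
  P.map (fun ω => ENNReal.log (likelihoodRatio P Q ω))

/-- `L` is a privacy loss distribution: it is the PLD of some pair of probability measures. -/
def IsPLD (L : Measure EReal) : Prop :=
  ∃ (Ω : Type) (_ : MeasurableSpace Ω) (P Q : Measure Ω),
    IsProbabilityMeasure P ∧ IsProbabilityMeasure Q ∧ L = pld P Q

/-- The Blackwell order on pairs of distributions: `(P, Q) ⪯ (P', Q')` if a single Markov kernel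
maps `P'` to `P` and `Q'` to `Q`. -/
def BlackwellLE {Ω Ω' : Type*} [MeasurableSpace Ω] [MeasurableSpace Ω']
    (P Q : Measure Ω) (P' Q' : Measure Ω') : Prop :=
  ∃ φ : Kernel Ω' Ω, IsMarkovKernel φ ∧ P = P'.bind φ ∧ Q = Q'.bind φ

/-- The Blackwell order on PLDs: `L ⪯ L'` if the two are the PLDs of pairs of probability
measures that are comparable in the Blackwell order. In particular both are PLDs. -/
def PLDLE (L L' : Measure EReal) : Prop :=
  ∃ (Ω : Type) (_ : MeasurableSpace Ω) (P Q : Measure Ω)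
    (Ω' : Type) (_ : MeasurableSpace Ω') (P' Q' : Measure Ω'),
    IsProbabilityMeasure P ∧ IsProbabilityMeasure Q ∧
    IsProbabilityMeasure P' ∧ IsProbabilityMeasure Q' ∧
    L = pld P Q ∧ L' = pld P' Q' ∧ BlackwellLE P Q P' Q'

/-- `S` is the supremum of the family `F` of PLDs: the PLD that dominates `F` and is dominated by
every PLD that dominates `F`. -/
def IsPLDSup (F : Set (Measure EReal)) (S : Measure EReal) : Prop :=
  IsPLD S ∧ (∀ L ∈ F, PLDLE L S) ∧ ∀ U, IsPLD U → (∀ L ∈ F, PLDLE L U) → PLDLE S U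

/-- The PLD `Id`: the distribution that is identically zero. -/
def pldId : Measure EReal := Measure.dirac 0

/-- `L₁ ⊕ ⋯ ⊕ Lₙ` (convolution of measures on `EReal`), with the empty convolution `Id`. -/
def convList (Ls : List (Measure EReal)) : Measure EReal :=
  Ls.foldr Measure.conv pldId

/-- `F^{<k}`: the convolutions of fewer than `k` members of `F`. -/
def convPowLT (F : Set (Measure EReal)) (k : ℕ) : Set (Measure EReal) :=
  {L | ∃ Ls : List (Measure EReal), Ls.length < k ∧ (∀ L' ∈ Ls, L' ∈ F) ∧ L = convList Ls}

/-! ### Adaptively composed mechanisms -/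

/-- An adaptively composed mechanism `M₁ ⊗ ⋯ ⊗ Mₖ` on datasets `D : 𝒟`, whose components may
moreover depend on a past outcome `x : X`. The first component is, for each dataset, a Markov
kernel from `X` to an arbitrary measurable space `Y`; the remaining ones may depend on `x` and
on the outcome `y : Y` of the first. -/
inductive AdaptiveMechanism (𝒟 : Type v) :
    ℕ → (X : Type u) → [MeasurableSpace X] → Type (max v (u + 1))
  | nil {X : Type u} [MeasurableSpace X] : AdaptiveMechanism 𝒟 0 X
  | cons {k : ℕ} {X : Type u} [MeasurableSpace X] (Y : Type u) [MeasurableSpace Y]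
      (κ : 𝒟 → Kernel X Y) (hκ : ∀ D, IsMarkovKernel (κ D))
      (next : AdaptiveMechanism 𝒟 k (X × Y)) : AdaptiveMechanism 𝒟 (k + 1) X

namespace AdaptiveMechanism

variable {𝒟 : Type v}

/-- The space `Y₁ × ⋯ × Yₖ` of joint outcomes. -/
def Out : {k : ℕ} → {X : Type u} → [MeasurableSpace X] → AdaptiveMechanism.{u, v} 𝒟 k X → Type u
  | _, _, _, nil => PUnit
  | _, _, _, cons Y _ _ next => Y × next.Out

/-- The product σ-algebra on the space of joint outcomes. -/
instance instMeasurableSpaceOut : {k : ℕ} → {X : Type u} → [MeasurableSpace X] →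
    (M : AdaptiveMechanism.{u, v} 𝒟 k X) → MeasurableSpace M.Out
  | _, _, _, nil => inferInstanceAs (MeasurableSpace PUnit)
  | _, _, _, cons Y _ _ next =>
    letI := instMeasurableSpaceOut next
    inferInstanceAs (MeasurableSpace (Y × next.Out))

/-- The law of the joint outcome `(Y₁, …, Yₖ)` on the dataset `D`, given the past outcome:
`Y₁` is drawn from the first component, and the rest from the remaining ones given `Y₁`. -/
def law (D : 𝒟) : {k : ℕ} → {X : Type u} → [MeasurableSpace X] →
    (M : AdaptiveMechanism.{u, v} 𝒟 k X) → Kernel X M.Out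
  | _, X, _, nil => (Kernel.const X (Measure.dirac PUnit.unit) : Kernel X PUnit)
  | _, X, _, cons Y κ _ next => (κ D ⊗ₖ next.law D : Kernel X (Y × next.Out))

/-- `M` is a `Γ`-adversary for the privacy rule `Γ` and the pair of datasets `D₁, D₂`, where
`hist x` lists the PLDs already played when the past outcome is `x`: for all past outcomes, the
PLD of each component belongs to the collection that `Γ` allows after the PLDs already played. -/
def Obeys (D₁ D₂ : 𝒟) (Γ : List (Measure EReal) → Set (Measure EReal)) :
    {k : ℕ} → {X : Type u} → [MeasurableSpace X] → AdaptiveMechanism.{u, v} 𝒟 k X →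
      (X → List (Measure EReal)) → Prop
  | _, _, _, nil, _ => True
  | _, _, _, cons _ κ _ next, hist =>
    (∀ x, pld (κ D₁ x) (κ D₂ x) ∈ Γ (hist x)) ∧
      next.Obeys D₁ D₂ Γ (fun p => hist p.1 ++ [pld (κ D₁ p.1) (κ D₂ p.1)])

end AdaptiveMechanism

/-! ### The natural filter -/

/-- The rule enforced by the natural filter with budget `B` and queries in `F`: after
`L₁, …, Lₘ`, a query with PLD `L ∈ F` is answered exactly when `L₁ ⊕ ⋯ ⊕ Lₘ ⊕ L ⪯ B`. -/
def filterRule (F : Set (Measure EReal)) (B : Measure EReal)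
    (Ls : List (Measure EReal)) : Set (Measure EReal) :=
  {L | L ∈ F ∧ PLDLE (convList (Ls ++ [L])) B}

/-- The natural filter with budget `B`, queries in `F` and query capacity `k` is free: every
adaptively composed mechanism of at most `k` queries that the filter lets through (queries not
used are queries with PLD `Id`) has itself a PLD that is dominated by `B`. -/
def FilterFree {𝒟 : Type v} (D₁ D₂ : 𝒟) (F : Set (Measure EReal)) (B : Measure EReal)
    (k : ℕ) : Prop :=
  ∀ M : AdaptiveMechanism.{u, v} 𝒟 k PUnit.{u + 1},
    M.Obeys D₁ D₂ (filterRule F B) (fun _ => []) →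
      PLDLE (pld (M.law D₁ PUnit.unit) (M.law D₂ PUnit.unit)) B

/-- Convolution commutes with suprema up to capacity `k`: for all `L ∈ F` and all nonempty
`F' ⊆ F^{<k}`, the supremum of `F'` exists and
`L ⊕ sup F' = sup {L ⊕ L' : L' ∈ F'}`. -/
def ConvCommutesSup (F : Set (Measure EReal)) (k : ℕ) : Prop :=
  ∀ L ∈ F, ∀ F' ⊆ convPowLT F k, F'.Nonempty →
    ∃ S, IsPLDSup F' S ∧ IsPLDSup {N | ∃ L' ∈ F', N = Measure.conv L L'} (Measure.conv L S)

end

end PrivacyLoss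

open PrivacyLoss

/-! A PLD `L` is studied through its hockey-stick function H_L(a, b) = ∫ (a - b e^{-t})⁺ dL(t), the
best value of a P(A) - b Q(A) over tests A. Three facts carry the proof. (1) Blackwell's theorem: `L
⪯ L'` exactly when H_L ≤ H_{L'} at all finite a, b (`PLDLE.hockeyStickLE`, `HockeyStickLE.pldLE`).
(2) Hockey-stick functions are, up to homogeneity, convex functions of one variable with fixed
values outside [0, 1], and this class is closed under pointwise suprema. So every nonempty family
has a supremum S, and H_S is the pointwise supremum (`exists_hockeyStick_eq_iSup`). (3) Convolution
is a mixture: H_{L⊕M}(a, b) is the mean of H_M(a, b e^{-s}) over s ∼ L (`hockeyStick_conv`).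

If (∗) holds, then after a first query `L` let T be the supremum of all continuations that the
filter still admits. By induction every remainder of the mechanism is dominated by T, so the
composition is dominated by L ⊕ T (`hockeyStickLE_compProd`). By (∗) this is the least upper bound
of the admissible totals L ⊕ L', all of which lie below the budget.

Conversely, let U dominate every L ⊕ L' with L' in a family with supremum S. With U as budget, an
adversary may play `L`, observe its loss s, and go on with an L' that nearly maximises H_{L'}(a, b
e^{-s}). This attains H_{L⊕S}(a, b) up to an arbitrarily small error, so freeness forces L ⊕ S ⪯ U
(`hockeyStickLE_conv_of_filterFree`). Rounding b e^{-s} to a grid leaves countably many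
continuations to choose from, which settles measurability. -/

namespace PrivacyLoss

open scoped ENNReal

/-! ### Hockey-stick divergences, optimal tests and data processing. -/

section Basic

variable {Ω : Type*} [MeasurableSpace Ω]

/-- The inverse likelihood ratio `exp (-t)` of a privacy loss `t`. -/
noncomputable def invRatio (t : EReal) : ℝ≥0∞ := (EReal.exp t)⁻¹

@[fun_prop]
lemma measurable_invRatio : Measurable invRatio := EReal.measurable_exp.inv

/-- The hockey-stick divergence `∫ (a - b exp (-t))⁺ dL(t)` of a privacy loss distribution. -/
noncomputable def hockeyStick (L : Measure EReal) (a b : ℝ≥0∞) : ℝ≥0∞ :=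
  ∫⁻ t, (a - b * invRatio t) ∂L

lemma measurable_hockeyStick_integrand (a b : ℝ≥0∞) :
    Measurable fun t => a - b * invRatio t := by fun_prop

@[fun_prop]
lemma measurable_likelihoodRatio (P Q : Measure Ω) : Measurable (likelihoodRatio P Q) :=
  (Measure.measurable_rnDeriv _ _).div (Measure.measurable_rnDeriv _ _)

lemma measurable_inv_likelihoodRatio (P Q : Measure Ω) :
    Measurable fun ω => (likelihoodRatio P Q ω)⁻¹ := (measurable_likelihoodRatio P Q).inv

lemma invRatio_log (x : ℝ≥0∞) : invRatio (ENNReal.log x) = x⁻¹ := by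
  simp [invRatio]

lemma lintegral_pld (P Q : Measure Ω) {f : EReal → ℝ≥0∞} (hf : Measurable f) :
    ∫⁻ t, f t ∂(pld P Q) = ∫⁻ ω, f (ENNReal.log (likelihoodRatio P Q ω)) ∂P :=
  lintegral_map hf (ENNReal.measurable_log.comp (measurable_likelihoodRatio P Q))

lemma hockeyStick_pld (P Q : Measure Ω) (a b : ℝ≥0∞) :
    hockeyStick (pld P Q) a b = ∫⁻ ω, (a - b * (likelihoodRatio P Q ω)⁻¹) ∂P := by
  rw [hockeyStick, lintegral_pld P Q (measurable_hockeyStick_integrand a b)]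
  simp_rw [invRatio_log]

instance isProbabilityMeasure_pld (P Q : Measure Ω) [IsProbabilityMeasure P] :
    IsProbabilityMeasure (pld P Q) :=
  Measure.isProbabilityMeasure_map
    (ENNReal.measurable_log.comp (measurable_likelihoodRatio P Q)).aemeasurable

lemma withDensity_rnDeriv_add_left (P Q : Measure Ω) [IsFiniteMeasure P] [IsFiniteMeasure Q] :
    (P + Q).withDensity (P.rnDeriv (P + Q)) = P :=
  Measure.withDensity_rnDeriv_eq _ _ (Measure.AbsolutelyContinuous.rfl.add_right Q)

lemma withDensity_rnDeriv_add_right (P Q : Measure Ω) [IsFiniteMeasure P] [IsFiniteMeasure Q] :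
    (P + Q).withDensity (Q.rnDeriv (P + Q)) = Q := by
  refine Measure.withDensity_rnDeriv_eq _ _ ?_
  rw [add_comm]
  exact Measure.AbsolutelyContinuous.rfl.add_right P

lemma measurableSet_rnDeriv_ne_zero (P Q : Measure Ω) :
    MeasurableSet {ω | P.rnDeriv (P + Q) ω ≠ 0} :=
  (Measure.measurable_rnDeriv P (P + Q) (measurableSet_singleton 0)).compl

/-- Where the density p of `P` is nonzero, p · (p / q)⁻¹ = q. What is lost is the part of `Q`
singular to `P`, which no PLD can see. -/
lemma withDensity_inv_likelihoodRatio (P Q : Measure Ω) [IsFiniteMeasure P] [IsFiniteMeasure Q] :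
    P.withDensity (fun ω => (likelihoodRatio P Q ω)⁻¹) =
      Q.restrict {ω | P.rnDeriv (P + Q) ω ≠ 0} := by
  set p := P.rnDeriv (P + Q) with hp
  set q := Q.rnDeriv (P + Q) with hq
  have hpm : Measurable p := Measure.measurable_rnDeriv _ _
  have hqm : Measurable q := Measure.measurable_rnDeriv _ _
  have h1 : P = (P + Q).withDensity p := (withDensity_rnDeriv_add_left P Q).symm
  have h2 : Q = (P + Q).withDensity q := (withDensity_rnDeriv_add_right P Q).symm
  have e1 : P.withDensity (fun ω => (likelihoodRatio P Q ω)⁻¹) =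
      (P + Q).withDensity (p * fun ω => (likelihoodRatio P Q ω)⁻¹) := by
    rw [withDensity_mul _ hpm (measurable_inv_likelihoodRatio P Q), ← h1]
  have e2 : Q.restrict {ω | p ω ≠ 0} = (P + Q).withDensity ({ω | p ω ≠ 0}.indicator q) := by
    rw [withDensity_indicator (measurableSet_rnDeriv_ne_zero P Q),
      ← restrict_withDensity (measurableSet_rnDeriv_ne_zero P Q), ← h2]
  rw [e1, e2]
  refine withDensity_congr_ae ?_
  filter_upwards [Measure.rnDeriv_lt_top P (P + Q), Measure.rnDeriv_lt_top Q (P + Q)] with ω hP hQ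
  change p ω * (p ω / q ω)⁻¹ = _
  by_cases h0 : p ω = 0
  · simp [h0]
  · rw [Set.indicator_of_mem (by exact h0), ENNReal.inv_div (Or.inl hQ.ne) (Or.inr h0),
      ENNReal.mul_div_cancel h0 hP.ne]

lemma lintegral_inv_likelihoodRatio_mul (P Q : Measure Ω) [IsFiniteMeasure P] [IsFiniteMeasure Q]
    {f : Ω → ℝ≥0∞} (hf : Measurable f) :
    ∫⁻ ω, (likelihoodRatio P Q ω)⁻¹ * f ω ∂P =
      ∫⁻ ω in {ω | P.rnDeriv (P + Q) ω ≠ 0}, f ω ∂Q := by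
  rw [← withDensity_inv_likelihoodRatio,
    lintegral_withDensity_eq_lintegral_mul _ (measurable_inv_likelihoodRatio P Q) hf]
  rfl

lemma lintegral_inv_likelihoodRatio_mul_le (P Q : Measure Ω) [IsFiniteMeasure P]
    [IsFiniteMeasure Q] {f : Ω → ℝ≥0∞} (hf : Measurable f) :
    ∫⁻ ω, (likelihoodRatio P Q ω)⁻¹ * f ω ∂P ≤ ∫⁻ ω, f ω ∂Q := by
  rw [lintegral_inv_likelihoodRatio_mul P Q hf]
  exact setLIntegral_le_lintegral _ _

lemma ae_rnDeriv_ne_zero (P Q : Measure Ω) [IsFiniteMeasure P] [IsFiniteMeasure Q] :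
    ∀ᵐ ω ∂P, P.rnDeriv (P + Q) ω ≠ 0 := by
  have h := withDensity_rnDeriv_add_left P Q
  have hm := Measure.measurable_rnDeriv P (P + Q)
  rw [ae_iff]
  simp only [not_not]
  have hs : MeasurableSet {ω | P.rnDeriv (P + Q) ω = 0} := hm (measurableSet_singleton 0)
  calc P {ω | P.rnDeriv (P + Q) ω = 0}
      = (P + Q).withDensity (P.rnDeriv (P + Q)) {ω | P.rnDeriv (P + Q) ω = 0} := by rw [h]
    _ = 0 := by
      rw [withDensity_apply _ hs]
      exact (setLIntegral_congr_fun hs (fun ω hω => hω)).trans (by simp)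

lemma ae_inv_likelihoodRatio_lt_top (P Q : Measure Ω) [IsFiniteMeasure P] [IsFiniteMeasure Q] :
    ∀ᵐ ω ∂P, (likelihoodRatio P Q ω)⁻¹ < ∞ := by
  refine ae_lt_top (measurable_inv_likelihoodRatio P Q) ?_
  have := lintegral_inv_likelihoodRatio_mul_le P Q (f := fun _ => 1) measurable_const
  simp only [mul_one, lintegral_const, one_mul] at this
  exact (this.trans_lt (measure_lt_top Q _)).ne

lemma mul_le_tsub_add_mul {f a c : ℝ≥0∞} (hf : f ≤ 1) : a * f ≤ (a - c) + c * f := by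
  calc a * f ≤ ((a - c) + c) * f := by gcongr; exact le_tsub_add
    _ = (a - c) * f + c * f := add_mul _ _ _
    _ ≤ (a - c) * 1 + c * f := by gcongr
    _ = _ := by rw [mul_one]

/-- Every randomized test obeys the hockey-stick bound. -/
lemma lintegral_test_le (P Q : Measure Ω) [IsFiniteMeasure P] [IsFiniteMeasure Q]
    (a b : ℝ≥0∞) {f : Ω → ℝ≥0∞} (hf : Measurable f) (hf1 : ∀ ω, f ω ≤ 1) :
    a * ∫⁻ ω, f ω ∂P ≤ hockeyStick (pld P Q) a b + b * ∫⁻ ω, f ω ∂Q := by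
  rw [hockeyStick_pld, ← lintegral_const_mul _ hf]
  calc ∫⁻ ω, a * f ω ∂P
      ≤ ∫⁻ ω, ((a - b * (likelihoodRatio P Q ω)⁻¹) +
          b * ((likelihoodRatio P Q ω)⁻¹ * f ω)) ∂P := by
        refine lintegral_mono fun ω => ?_
        rw [← mul_assoc]
        exact mul_le_tsub_add_mul (hf1 ω)
    _ = ∫⁻ ω, (a - b * (likelihoodRatio P Q ω)⁻¹) ∂P +
          b * ∫⁻ ω, (likelihoodRatio P Q ω)⁻¹ * f ω ∂P := by
        rw [lintegral_add_left (by fun_prop), lintegral_const_mul _ (by fun_prop)]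
    _ ≤ _ := by
        exact add_le_add le_rfl (mul_le_mul_right (lintegral_inv_likelihoodRatio_mul_le P Q hf) _)

/-- The optimal test for the hockey-stick divergence. -/
def optimalTest (P Q : Measure Ω) (a b : ℝ≥0∞) : Set Ω :=
  {ω | b * (likelihoodRatio P Q ω)⁻¹ < a} ∩ {ω | P.rnDeriv (P + Q) ω ≠ 0}

lemma measurableSet_optimalTest (P Q : Measure Ω) (a b : ℝ≥0∞) :
    MeasurableSet (optimalTest P Q a b) := by
  refine MeasurableSet.inter ?_ (measurableSet_rnDeriv_ne_zero P Q)
  exact measurableSet_lt (measurable_const.mul (measurable_inv_likelihoodRatio P Q))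
    measurable_const

/-- The equality case of `lintegral_test_le`: the truncation is inactive on the test, and the
integrand vanishes `P`-almost everywhere off it. The additive form avoids truncated subtraction. -/
lemma hockeyStick_add_optimalTest (P Q : Measure Ω) [IsFiniteMeasure P] [IsFiniteMeasure Q]
    (a b : ℝ≥0∞) :
    hockeyStick (pld P Q) a b + b * Q (optimalTest P Q a b) = a * P (optimalTest P Q a b) := by
  set A := optimalTest P Q a b with hA
  have hAm : MeasurableSet A := measurableSet_optimalTest P Q a b
  have hm := measurable_inv_likelihoodRatio P Q
  -- The test lies in the set where the density of `P` is nonzero, so no singular part of `Q` is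
  -- missed.
  have hQ : Q A = ∫⁻ ω, (likelihoodRatio P Q ω)⁻¹ * A.indicator 1 ω ∂P := by
    rw [lintegral_inv_likelihoodRatio_mul P Q (measurable_one.indicator hAm),
      lintegral_indicator_one hAm, Measure.restrict_apply hAm]
    congr 1
    ext ω
    simp only [hA, optimalTest, Set.mem_inter_iff]
    tauto
  have h1m : Measurable (A.indicator (1 : Ω → ℝ≥0∞)) := measurable_one.indicator hAm
  rw [hockeyStick_pld, hQ,
    ← lintegral_const_mul b (f := fun ω => (likelihoodRatio P Q ω)⁻¹ * A.indicator 1 ω)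
      (hm.mul h1m),
    ← lintegral_add_left (by fun_prop), ← lintegral_indicator_one hAm,
    ← lintegral_const_mul _ h1m]
  refine lintegral_congr_ae ?_
  filter_upwards [ae_rnDeriv_ne_zero P Q] with ω hω
  by_cases h : ω ∈ A
  · simp only [Set.indicator_of_mem h, Pi.one_apply, mul_one]
    exact tsub_add_cancel_of_le h.1.le
  · simp only [Set.indicator_of_notMem h, mul_zero, add_zero]
    have : ¬ b * (likelihoodRatio P Q ω)⁻¹ < a := fun h' => h ⟨h', hω⟩
    exact tsub_eq_zero_of_le (not_lt.mp this)

/-- Data processing for the hockey-stick divergence. -/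
lemma BlackwellLE.hockeyStick_le {Ω' : Type*} [MeasurableSpace Ω'] {P Q : Measure Ω}
    {P' Q' : Measure Ω'} [IsFiniteMeasure P] [IsFiniteMeasure Q] [IsFiniteMeasure P']
    [IsFiniteMeasure Q'] (h : BlackwellLE P Q P' Q') (a : ℝ≥0∞) {b : ℝ≥0∞} (hb : b ≠ ∞) :
    hockeyStick (pld P Q) a b ≤ hockeyStick (pld P' Q') a b := by
  obtain ⟨φ, hφ, hP, hQ⟩ := h
  set A := optimalTest P Q a b
  have hAm : MeasurableSet A := measurableSet_optimalTest P Q a b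
  have h1 := hockeyStick_add_optimalTest P Q a b
  -- Pulled back along `φ`, the optimal test for (P, Q) becomes a randomized test for (P', Q') with
  -- the same two masses.
  have h2 := lintegral_test_le P' Q' a b (f := fun ω => φ ω A) (φ.measurable_coe hAm)
    (fun ω => prob_le_one)
  rw [← Measure.bind_apply hAm φ.aemeasurable, ← Measure.bind_apply hAm φ.aemeasurable,
    ← hP, ← hQ, ← h1] at h2
  exact (ENNReal.add_le_add_iff_right (ENNReal.mul_ne_top hb (measure_ne_top _ _))).1 h2

/-- The pointwise order of hockey-stick divergences. -/
def HockeyStickLE (L L' : Measure EReal) : Prop :=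
  ∀ a b : ℝ≥0∞, a ≠ ∞ → b ≠ ∞ → hockeyStick L a b ≤ hockeyStick L' a b

lemma HockeyStickLE.trans {L L' L'' : Measure EReal} (h : HockeyStickLE L L')
    (h' : HockeyStickLE L' L'') : HockeyStickLE L L'' :=
  fun a b ha hb => (h a b ha hb).trans (h' a b ha hb)

lemma PLDLE.hockeyStickLE {L L' : Measure EReal} (h : PLDLE L L') : HockeyStickLE L L' := by
  obtain ⟨Ω, _, P, Q, Ω', _, P', Q', _, _, _, _, rfl, rfl, hB⟩ := h
  exact fun a b _ hb => hB.hockeyStick_le a hb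

/-! ### Loss laws and their convolution. -/

/-- An intrinsic description of privacy loss distributions. -/
structure IsLossLaw (L : Measure EReal) : Prop where
  prob : IsProbabilityMeasure L
  lintegral_invRatio_le : ∫⁻ t, invRatio t ∂L ≤ 1

lemma isLossLaw_pld (P Q : Measure Ω) [IsProbabilityMeasure P] [IsProbabilityMeasure Q] :
    IsLossLaw (pld P Q) := by
  refine ⟨inferInstance, ?_⟩
  rw [lintegral_pld P Q measurable_invRatio]
  simp_rw [invRatio_log]
  have := lintegral_inv_likelihoodRatio_mul_le P Q (f := fun _ => 1) measurable_const
  simpa using this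

lemma IsPLD.isLossLaw {L : Measure EReal} (h : IsPLD L) : IsLossLaw L := by
  obtain ⟨Ω, _, P, Q, _, _, rfl⟩ := h
  exact isLossLaw_pld P Q

lemma IsLossLaw.ae_invRatio_ne_top {L : Measure EReal} (h : IsLossLaw L) :
    ∀ᵐ t ∂L, invRatio t ≠ ∞ := by
  have := ae_lt_top (μ := L) measurable_invRatio (h.2.trans_lt ENNReal.one_lt_top).ne
  filter_upwards [this] with t ht using ht.ne

/-- Finiteness excludes the value `⊥`, where `⊥ + ⊤ = ⊥` would break multiplicativity; loss laws do
not charge it. -/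
lemma invRatio_add {s t : EReal} (hs : invRatio s ≠ ∞) (ht : invRatio t ≠ ∞) :
    invRatio (s + t) = invRatio s * invRatio t := by
  unfold invRatio at *
  rw [EReal.exp_add, ENNReal.mul_inv]
  · left; simpa using hs
  · right; simpa using ht

lemma lintegral_comp_invRatio_conv {L M : Measure EReal} (hL : IsLossLaw L) (hM : IsLossLaw M)
    {f : ℝ≥0∞ → ℝ≥0∞} (hf : Measurable f) :
    ∫⁻ t, f (invRatio t) ∂(L.conv M) =
      ∫⁻ s, ∫⁻ t, f (invRatio s * invRatio t) ∂M ∂L := by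
  have := hL.prob
  have := hM.prob
  rw [Measure.lintegral_conv (f := fun t => f (invRatio t)) (hf.comp measurable_invRatio)]
  refine lintegral_congr_ae ?_
  filter_upwards [hL.ae_invRatio_ne_top] with s hs
  refine lintegral_congr_ae ?_
  filter_upwards [hM.ae_invRatio_ne_top] with t ht
  simp only [invRatio_add hs ht]

/-- A loss s in the first factor only rescales b to b e^{-s}. The two-parameter form of the
divergence is kept for the sake of this identity. -/
lemma hockeyStick_conv {L M : Measure EReal} (hL : IsLossLaw L) (hM : IsLossLaw M)
    (a b : ℝ≥0∞) :
    hockeyStick (L.conv M) a b = ∫⁻ s, hockeyStick M a (b * invRatio s) ∂L := by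
  unfold hockeyStick
  rw [lintegral_comp_invRatio_conv hL hM (f := fun x => a - b * x) (by fun_prop)]
  simp_rw [mul_assoc]

lemma IsLossLaw.conv {L M : Measure EReal} (hL : IsLossLaw L) (hM : IsLossLaw M) :
    IsLossLaw (L.conv M) := by
  have := hL.prob
  have := hM.prob
  refine ⟨inferInstance, ?_⟩
  rw [lintegral_comp_invRatio_conv hL hM (f := fun x => x) measurable_id]
  calc ∫⁻ s, ∫⁻ t, invRatio s * invRatio t ∂M ∂L
      ≤ ∫⁻ s, invRatio s ∂L := by
        refine lintegral_mono fun s => ?_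
        rw [lintegral_const_mul _ measurable_invRatio]
        exact mul_le_of_le_one_right' hM.2
    _ ≤ 1 := hL.2

lemma hockeyStick_zero_left (L : Measure EReal) (b : ℝ≥0∞) : hockeyStick L 0 b = 0 := by
  simp [hockeyStick]

lemma hockeyStick_zero_right {L : Measure EReal} (hL : IsLossLaw L) (a : ℝ≥0∞) :
    hockeyStick L a 0 = a := by
  have := hL.prob
  simp [hockeyStick]

lemma hockeyStick_mul (L : Measure EReal) {c : ℝ≥0∞} (hc : c ≠ ∞) (a b : ℝ≥0∞) :
    hockeyStick L (c * a) (c * b) = c * hockeyStick L a b := by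
  unfold hockeyStick
  rw [← lintegral_const_mul _ (by fun_prop)]
  refine lintegral_congr fun t => ?_
  rw [ENNReal.mul_sub (fun _ _ => hc), mul_assoc]

lemma hockeyStick_anti (L : Measure EReal) (a : ℝ≥0∞) {b b' : ℝ≥0∞} (h : b ≤ b') :
    hockeyStick L a b' ≤ hockeyStick L a b := by
  unfold hockeyStick
  gcongr

/-- The divergence is 1-Lipschitz in b because the mean of e^{-t} is at most 1. The constant is the
same for all laws, so one grid in b later serves every continuation. -/
lemma hockeyStick_le_add {L : Measure EReal} (hL : IsLossLaw L) (a : ℝ≥0∞) {b b' : ℝ≥0∞}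
    {ε : ℝ≥0∞} (h : b' ≤ b + ε) : hockeyStick L a b ≤ hockeyStick L a b' + ε := by
  calc hockeyStick L a b ≤ ∫⁻ t, ((a - b' * invRatio t) + ε * invRatio t) ∂L := by
        refine lintegral_mono fun t => ?_
        rw [tsub_le_iff_right, add_assoc, ← add_mul, add_comm ε b]
        exact le_tsub_add.trans (by gcongr)
    _ = hockeyStick L a b' + ε * ∫⁻ t, invRatio t ∂L := by
        rw [lintegral_add_left (by fun_prop), lintegral_const_mul _ measurable_invRatio]; rfl
    _ ≤ _ := by
        gcongr
        exact mul_le_of_le_one_right' hL.2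

lemma hockeyStick_le_self {L : Measure EReal} (hL : IsLossLaw L) (a b : ℝ≥0∞) :
    hockeyStick L a b ≤ a :=
  (hockeyStick_anti L a (zero_le)).trans_eq (hockeyStick_zero_right hL a)

lemma measurable_hockeyStick (L : Measure EReal) (a : ℝ≥0∞) : Measurable (hockeyStick L a) :=
  Antitone.measurable fun _ _ h => hockeyStick_anti L a h

lemma isLossLaw_pldId : IsLossLaw pldId := by
  refine ⟨by unfold pldId; infer_instance, ?_⟩
  simp [pldId, invRatio]

lemma hockeyStick_pldId (a b : ℝ≥0∞) : hockeyStick pldId a b = a - b := by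
  simp [pldId, hockeyStick, invRatio]

lemma pldId_hockeyStickLE {L : Measure EReal} (hL : IsLossLaw L) : HockeyStickLE pldId L := by
  intro a b _ hb
  have := hL.prob
  rw [hockeyStick_pldId, tsub_le_iff_right]
  have := hockeyStick_le_add hL a (b := 0) (b' := b) (ε := b) (by simp)
  rwa [hockeyStick_zero_right hL] at this

lemma HockeyStickLE.conv_left {L M M' : Measure EReal} (hL : IsLossLaw L) (hM : IsLossLaw M)
    (hM' : IsLossLaw M') (h : HockeyStickLE M M') :
    HockeyStickLE (L.conv M) (L.conv M') := by
  intro a b ha hb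
  rw [hockeyStick_conv hL hM, hockeyStick_conv hL hM']
  refine lintegral_mono_ae ?_
  filter_upwards [hL.ae_invRatio_ne_top] with s hs
  exact h a _ ha (ENNReal.mul_ne_top hb hs)

lemma convList_cons (L : Measure EReal) (Ls : List (Measure EReal)) :
    convList (L :: Ls) = L.conv (convList Ls) := rfl

lemma isLossLaw_convList {Ls : List (Measure EReal)} (h : ∀ L ∈ Ls, IsLossLaw L) :
    IsLossLaw (convList Ls) := by
  induction Ls with
  | nil => exact isLossLaw_pldId
  | cons L Ls ih =>
    rw [convList_cons]
    exact (h L (by simp)).conv (ih fun L' hL' => h L' (by simp [hL']))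

lemma convList_append_hockeyStickLE {Ls Ls' Ls'' : List (Measure EReal)}
    (h : ∀ L ∈ Ls, IsLossLaw L) (h' : ∀ L ∈ Ls', IsLossLaw L) (h'' : ∀ L ∈ Ls'', IsLossLaw L)
    (hle : HockeyStickLE (convList Ls') (convList Ls'')) :
    HockeyStickLE (convList (Ls ++ Ls')) (convList (Ls ++ Ls'')) := by
  induction Ls with
  | nil => exact hle
  | cons L Ls ih =>
    have hLs : ∀ L ∈ Ls, IsLossLaw L := fun L' hL' => h L' (by simp [hL'])
    rw [List.cons_append, List.cons_append, convList_cons, convList_cons]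
    refine HockeyStickLE.conv_left (h L (by simp)) (isLossLaw_convList ?_)
      (isLossLaw_convList ?_) (ih hLs)
    · intro M hM
      rcases List.mem_append.1 hM with hM | hM
      exacts [hLs M hM, h' M hM]
    · intro M hM
      rcases List.mem_append.1 hM with hM | hM
      exacts [hLs M hM, h'' M hM]

/-- Since `Id` is least, a sequence whose total is within budget has all its prefixes within budget,
as the filter requires. -/
lemma convList_hockeyStickLE_append {Ls Ls' : List (Measure EReal)}
    (h : ∀ L ∈ Ls, IsLossLaw L) (h' : ∀ L ∈ Ls', IsLossLaw L) :
    HockeyStickLE (convList Ls) (convList (Ls ++ Ls')) := by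
  have := convList_append_hockeyStickLE h (Ls' := []) (by simp) h'
    (pldId_hockeyStickLE (isLossLaw_convList h'))
  rwa [List.append_nil] at this

end Basic

/-! ### PLDs as laws on [0, 1] with mean 1/2. -/

section Representation

variable {Ω : Type*} [MeasurableSpace Ω]

/-- The privacy loss distribution of the pair with densities `1 - q` and `q` with respect to `ν`. -/
noncomputable def lossOf (ν : Measure Ω) (q : Ω → ℝ≥0∞) : Measure EReal :=
  pld (ν.withDensity fun ω => 1 - q ω) (ν.withDensity q)

lemma withDensity_add_withDensity_one_sub (ν : Measure Ω) {q : Ω → ℝ≥0∞} (hq : Measurable q)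
    (hq1 : ∀ᵐ ω ∂ν, q ω ≤ 1) : ν.withDensity (fun ω => 1 - q ω) + ν.withDensity q = ν := by
  rw [← withDensity_add_right _ hq]
  conv_rhs => rw [← withDensity_one (μ := ν)]
  refine withDensity_congr_ae ?_
  filter_upwards [hq1] with ω hω using tsub_add_cancel_of_le hω

lemma lintegral_lossOf (ν : Measure Ω) [IsFiniteMeasure ν] {q : Ω → ℝ≥0∞} (hq : Measurable q)
    (hq1 : ∀ᵐ ω ∂ν, q ω ≤ 1) {f : EReal → ℝ≥0∞} (hf : Measurable f) :
    ∫⁻ t, f t ∂(lossOf ν q) =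
      ∫⁻ ω, (1 - q ω) * f (ENNReal.log ((1 - q ω) / q ω)) ∂ν := by
  have hp : Measurable fun ω => 1 - q ω := measurable_const.sub hq
  have hm : Measurable fun ω => f (ENNReal.log ((1 - q ω) / q ω)) :=
    hf.comp (ENNReal.measurable_log.comp (hp.div hq))
  have hLR : ∀ᵐ ω ∂ν, likelihoodRatio (ν.withDensity fun ω => 1 - q ω) (ν.withDensity q) ω =
      (1 - q ω) / q ω := by
    unfold likelihoodRatio
    rw [withDensity_add_withDensity_one_sub ν hq hq1]
    filter_upwards [Measure.rnDeriv_withDensity ν hp, Measure.rnDeriv_withDensity ν hq]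
      with ω h1 h2
    rw [h1, h2]
  rw [lossOf, lintegral_pld _ _ hf]
  calc ∫⁻ ω, f (ENNReal.log (likelihoodRatio (ν.withDensity fun ω => 1 - q ω)
        (ν.withDensity q) ω)) ∂(ν.withDensity fun ω => 1 - q ω)
      = ∫⁻ ω, f (ENNReal.log ((1 - q ω) / q ω)) ∂(ν.withDensity fun ω => 1 - q ω) := by
        refine lintegral_congr_ae ?_
        filter_upwards [(withDensity_absolutelyContinuous ν _).ae_le hLR] with ω hω
        rw [hω]
    _ = _ := lintegral_withDensity_eq_lintegral_mul _ hp hm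

lemma hockeyStick_lossOf (ν : Measure Ω) [IsFiniteMeasure ν] {q : Ω → ℝ≥0∞} (hq : Measurable q)
    (hq1 : ∀ᵐ ω ∂ν, q ω ≤ 1) (a b : ℝ≥0∞) :
    hockeyStick (lossOf ν q) a b = ∫⁻ ω, (a * (1 - q ω) - b * q ω) ∂ν := by
  rw [hockeyStick, lintegral_lossOf ν hq hq1 (measurable_hockeyStick_integrand a b)]
  refine lintegral_congr_ae ?_
  filter_upwards [hq1] with ω hω
  have hne : 1 - q ω ≠ ∞ := ne_top_of_le_ne_top ENNReal.one_ne_top tsub_le_self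
  by_cases h0 : 1 - q ω = 0
  · simp [h0]
  · rw [invRatio_log, ENNReal.inv_div (Or.inl (ne_top_of_le_ne_top ENNReal.one_ne_top hω))
      (Or.inr h0), ENNReal.mul_sub (fun _ _ => hne), mul_left_comm,
      ENNReal.mul_div_cancel h0 hne, mul_comm a]

lemma mul_one_sub_tsub {c q : ℝ≥0∞} (hc : c ≤ 1) (hq : q ≤ 1) :
    c * (1 - q) - (1 - c) * q = c - q := by
  have hc' : c ≠ ∞ := ne_top_of_le_ne_top ENNReal.one_ne_top hc
  have hq' : q ≠ ∞ := ne_top_of_le_ne_top ENNReal.one_ne_top hq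
  rw [ENNReal.mul_sub (fun _ _ => hc'), ENNReal.sub_mul (fun _ _ => hq'), mul_one, one_mul,
    tsub_tsub, add_tsub_cancel_of_le]
  exact mul_le_of_le_one_left' hc

/-- On the line a + b = 1, which by homogeneity carries all the information, the divergence is a
partial first moment of the density `q`. -/
lemma hockeyStick_lossOf_one_sub (ν : Measure Ω) [IsFiniteMeasure ν] {q : Ω → ℝ≥0∞}
    (hq : Measurable q) (hq1 : ∀ᵐ ω ∂ν, q ω ≤ 1) {c : ℝ≥0∞} (hc : c ≤ 1) :
    hockeyStick (lossOf ν q) c (1 - c) = ∫⁻ ω, (c - q ω) ∂ν := by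
  rw [hockeyStick_lossOf ν hq hq1]
  refine lintegral_congr_ae ?_
  filter_upwards [hq1] with ω hω using mul_one_sub_tsub hc hω

lemma lossOf_congr (ν : Measure Ω) {q q' : Ω → ℝ≥0∞} (h : q =ᵐ[ν] q') :
    lossOf ν q = lossOf ν q' := by
  have h' : (fun ω => 1 - q ω) =ᵐ[ν] fun ω => 1 - q' ω := h.fun_comp fun x => 1 - x
  unfold lossOf
  rw [withDensity_congr_ae h, withDensity_congr_ae h']

/-- A PLD depends only on the law of the density under the dominating measure; this moves every pair
to the real line. -/
lemma lossOf_map {Ω' : Type*} [MeasurableSpace Ω'] (ν : Measure Ω) [IsFiniteMeasure ν]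
    {X : Ω → Ω'} (hX : Measurable X) {q : Ω' → ℝ≥0∞} (hq : Measurable q)
    (hq1 : ∀ᵐ ω ∂(ν.map X), q ω ≤ 1) :
    lossOf (ν.map X) q = lossOf ν (q ∘ X) := by
  refine Measure.ext_of_lintegral _ fun f hf => ?_
  rw [lintegral_lossOf _ hq hq1 hf,
    lintegral_lossOf _ (hq.comp hX) (ae_of_ae_map hX.aemeasurable hq1) hf, lintegral_map _ hX]
  · rfl
  · exact (measurable_const.sub hq).mul
      (hf.comp (ENNReal.measurable_log.comp ((measurable_const.sub hq).div hq)))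

lemma rnDeriv_add_rnDeriv_eq_one (P Q : Measure Ω) [IsFiniteMeasure P] [IsFiniteMeasure Q] :
    ∀ᵐ ω ∂(P + Q), P.rnDeriv (P + Q) ω + Q.rnDeriv (P + Q) ω = 1 := by
  filter_upwards [Measure.rnDeriv_add P Q (P + Q), Measure.rnDeriv_self (P + Q)] with ω h1 h2
  rw [h2] at h1
  exact h1.symm

lemma pld_eq_lossOf (P Q : Measure Ω) [IsFiniteMeasure P] [IsFiniteMeasure Q] :
    pld P Q = lossOf (P + Q) (Q.rnDeriv (P + Q)) := by
  unfold lossOf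
  rw [withDensity_rnDeriv_add_right]
  congr 1
  conv_lhs => rw [← withDensity_rnDeriv_add_left P Q]
  refine withDensity_congr_ae ?_
  filter_upwards [rnDeriv_add_rnDeriv_eq_one P Q, Measure.rnDeriv_lt_top Q (P + Q)] with ω h h'
  exact ENNReal.eq_sub_of_add_eq h'.ne h

/-- The laws on `[0, 1]` with mean `1 / 2` represent the privacy loss distributions. -/
structure IsCenteredLaw (μ : Measure ℝ) : Prop where
  prob : IsProbabilityMeasure μ
  ae_mem : ∀ᵐ x ∂μ, x ∈ Set.Icc (0 : ℝ) 1
  two_mul_lintegral : 2 * ∫⁻ x, ENNReal.ofReal x ∂μ = 1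

lemma IsCenteredLaw.ae_le {μ : Measure ℝ} (h : IsCenteredLaw μ) :
    ∀ᵐ x ∂((2 : ℝ≥0∞) • μ), ENNReal.ofReal x ≤ 1 := by
  refine Measure.ae_smul_measure ?_ _
  filter_upwards [h.ae_mem] with x hx
  exact ENNReal.ofReal_le_one.2 hx.2

/-- The law is that of dQ/d(P+Q) under (P+Q)/2. Its mean is half the mass of `Q`. -/
lemma exists_isCenteredLaw (P Q : Measure Ω) [IsProbabilityMeasure P] [IsProbabilityMeasure Q] :
    ∃ μ : Measure ℝ, IsCenteredLaw μ ∧ pld P Q = lossOf ((2 : ℝ≥0∞) • μ) ENNReal.ofReal := by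
  set q := Q.rnDeriv (P + Q) with hq
  have hqm : Measurable q := Measure.measurable_rnDeriv _ _
  have hq1 : ∀ᵐ ω ∂(P + Q), q ω ≤ 1 := by
    filter_upwards [rnDeriv_add_rnDeriv_eq_one P Q] with ω h
    exact h ▸ le_add_self
  have hX : Measurable fun ω => (q ω).toReal := hqm.ennreal_toReal
  have hofReal : (fun ω => ENNReal.ofReal (q ω).toReal) =ᵐ[P + Q] q := by
    filter_upwards [hq1] with ω h
    exact ENNReal.ofReal_toReal (ne_top_of_le_ne_top ENNReal.one_ne_top h)
  set μ : Measure ℝ := (2 : ℝ≥0∞)⁻¹ • (P + Q).map (fun ω => (q ω).toReal) with hμ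
  have h2 : (2 : ℝ≥0∞) • μ = (P + Q).map (fun ω => (q ω).toReal) := by
    rw [hμ, smul_smul, ENNReal.mul_inv_cancel (by simp) (by simp), one_smul]
  have hmem : ∀ᵐ x ∂((P + Q).map (fun ω => (q ω).toReal)), x ∈ Set.Icc (0 : ℝ) 1 := by
    refine (ae_map_iff (p := fun x => x ∈ Set.Icc (0 : ℝ) 1) hX.aemeasurable
      measurableSet_Icc).2 ?_
    filter_upwards [hq1] with ω h
    exact ⟨ENNReal.toReal_nonneg, ENNReal.toReal_le_of_le_ofReal zero_le_one (by simpa using h)⟩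
  have hc : IsCenteredLaw μ := by
    refine ⟨⟨?_⟩, Measure.ae_smul_measure hmem _, ?_⟩
    · rw [hμ, Measure.smul_apply, Measure.map_apply hX MeasurableSet.univ]
      simp only [Set.preimage_univ, Measure.add_apply, measure_univ, smul_eq_mul]
      rw [one_add_one_eq_two, ENNReal.inv_mul_cancel (by simp) (by simp)]
    · have : (2 : ℝ≥0∞) * ∫⁻ x, ENNReal.ofReal x ∂μ = ∫⁻ x, ENNReal.ofReal x ∂((2 : ℝ≥0∞) • μ) :=
        (lintegral_smul_measure (μ := μ) (2 : ℝ≥0∞) ENNReal.ofReal).symm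
      rw [this, h2, lintegral_map ENNReal.measurable_ofReal hX, lintegral_congr_ae hofReal,
        ← setLIntegral_univ, ← withDensity_apply _ MeasurableSet.univ,
        withDensity_rnDeriv_add_right, measure_univ]
  refine ⟨μ, hc, ?_⟩
  have := hc.prob
  rw [pld_eq_lossOf, h2, lossOf_map _ hX ENNReal.measurable_ofReal (h2 ▸ hc.ae_le)]
  exact (lossOf_congr _ hofReal).symm

lemma IsCenteredLaw.isProbabilityMeasure_withDensity {μ : Measure ℝ} (h : IsCenteredLaw μ) :
    IsProbabilityMeasure (((2 : ℝ≥0∞) • μ).withDensity fun x => 1 - ENNReal.ofReal x) ∧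
      IsProbabilityMeasure (((2 : ℝ≥0∞) • μ).withDensity ENNReal.ofReal) := by
  have := h.prob
  have hQ : (((2 : ℝ≥0∞) • μ).withDensity ENNReal.ofReal) Set.univ = 1 := by
    rw [withDensity_apply _ MeasurableSet.univ, setLIntegral_univ, lintegral_smul_measure,
      smul_eq_mul, h.two_mul_lintegral]
  refine ⟨⟨?_⟩, ⟨hQ⟩⟩
  have hs := congrArg (fun m => m Set.univ)
    (withDensity_add_withDensity_one_sub _ ENNReal.measurable_ofReal h.ae_le)
  simp only [Measure.add_apply, hQ, Measure.smul_apply, measure_univ, smul_eq_mul, mul_one] at hs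
  exact (ENNReal.add_left_inj ENNReal.one_ne_top).1 (hs.trans one_add_one_eq_two.symm)

lemma IsCenteredLaw.isPLD {μ : Measure ℝ} (h : IsCenteredLaw μ) :
    IsPLD (lossOf ((2 : ℝ≥0∞) • μ) ENNReal.ofReal) :=
  ⟨ℝ, inferInstance, _, _, h.isProbabilityMeasure_withDensity.1,
    h.isProbabilityMeasure_withDensity.2, rfl⟩

lemma IsPLD.exists_isCenteredLaw {L : Measure EReal} (h : IsPLD L) :
    ∃ μ : Measure ℝ, IsCenteredLaw μ ∧ L = lossOf ((2 : ℝ≥0∞) • μ) ENNReal.ofReal := by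
  obtain ⟨Ω, _, P, Q, _, _, rfl⟩ := h
  exact PrivacyLoss.exists_isCenteredLaw P Q

lemma isPLD_pld (P Q : Measure Ω) [IsProbabilityMeasure P] [IsProbabilityMeasure Q] :
    IsPLD (pld P Q) := by
  obtain ⟨μ, hμ, h⟩ := PrivacyLoss.exists_isCenteredLaw P Q
  exact h ▸ hμ.isPLD

lemma one_sub_one_sub_inv_one_add (s : ℝ≥0∞) : 1 - (1 - (1 + s)⁻¹) = (1 + s)⁻¹ :=
  ENNReal.sub_sub_cancel ENNReal.one_ne_top (ENNReal.inv_le_one.2 le_self_add)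

lemma one_add_mul_one_sub_inv {s : ℝ≥0∞} (hs : s ≠ ∞) : (1 + s) * (1 - (1 + s)⁻¹) = s := by
  have h : 1 + s ≠ ∞ := ENNReal.add_ne_top.2 ⟨ENNReal.one_ne_top, hs⟩
  rw [ENNReal.mul_sub (fun _ _ => h), mul_one, ENNReal.mul_inv_cancel (by simp) h,
    ENNReal.add_sub_cancel_left ENNReal.one_ne_top]

lemma inv_one_add_div {s : ℝ≥0∞} (hs : s ≠ ∞) : (1 + s)⁻¹ / (1 - (1 + s)⁻¹) = s⁻¹ := by
  have h : 1 + s ≠ ∞ := ENNReal.add_ne_top.2 ⟨ENNReal.one_ne_top, hs⟩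
  conv_rhs => rw [← one_add_mul_one_sub_inv hs]
  rw [ENNReal.mul_inv (Or.inl (by simp)) (Or.inl h), ENNReal.div_eq_inv_mul, mul_comm]

lemma log_inv_invRatio (t : EReal) : ENNReal.log (invRatio t)⁻¹ = t := by
  simp [invRatio]

/-- A realizing pair is P = L and Q = e^{-t} L plus the missing mass 1 - m at `⊥`, a point that `L`
does not charge. With ν = P + Q and s = e^{-t}, the density of Q is s/(1+s) = 1 - (1+s)⁻¹, which
equals 1 at `⊥`. -/
lemma IsLossLaw.isPLD {L : Measure EReal} (h : IsLossLaw L) : IsPLD L := by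
  have := h.prob
  set m := ∫⁻ t, invRatio t ∂L with hm
  have hm1 : m ≤ 1 := h.2
  have hs := measurable_invRatio
  have h1s : Measurable fun t => 1 + invRatio t := measurable_const.add hs
  set q : EReal → ℝ≥0∞ := fun t => 1 - (1 + invRatio t)⁻¹ with hq
  have hqm : Measurable q := measurable_const.sub h1s.inv
  have hq1 : ∀ t, q t ≤ 1 := fun t => tsub_le_self
  set ν : Measure EReal := L.withDensity (fun t => 1 + invRatio t) +
    (1 - m) • Measure.dirac ⊥ with hν
  have hlint : ∀ f : EReal → ℝ≥0∞, Measurable f →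
      ∫⁻ t, f t ∂ν = ∫⁻ t, (1 + invRatio t) * f t ∂L + (1 - m) * f ⊥ := by
    intro f hf
    rw [hν, lintegral_add_measure, lintegral_smul_measure, lintegral_dirac' _ hf,
      lintegral_withDensity_eq_lintegral_mul _ h1s hf]
    rfl
  have hbot : invRatio ⊥ = ∞ := by simp [invRatio]
  have hfin : IsFiniteMeasure ν := by
    constructor
    have := hlint (fun _ => 1) measurable_const
    simp only [lintegral_one, mul_one] at this
    rw [this, lintegral_add_left measurable_const, lintegral_one, measure_univ]
    exact ENNReal.add_lt_top.2 ⟨ENNReal.add_lt_top.2 ⟨ENNReal.one_lt_top,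
      hm1.trans_lt ENNReal.one_lt_top⟩, tsub_le_self.trans_lt ENNReal.one_lt_top⟩
  have hL : L = lossOf ν q := by
    refine Measure.ext_of_lintegral _ fun f hf => ?_
    rw [lintegral_lossOf ν hqm (.of_forall hq1) hf, hlint]
    · simp only [hq, one_sub_one_sub_inv_one_add]
      simp only [hbot, add_top, ENNReal.inv_top, zero_mul, mul_zero, add_zero]
      refine lintegral_congr_ae ?_
      filter_upwards [h.ae_invRatio_ne_top] with t ht
      have h' : 1 + invRatio t ≠ ∞ := ENNReal.add_ne_top.2 ⟨ENNReal.one_ne_top, ht⟩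
      rw [← mul_assoc, ENNReal.mul_inv_cancel (by simp) h', one_mul, inv_one_add_div ht,
        log_inv_invRatio]
    · exact (measurable_const.sub hqm).mul
        (hf.comp (ENNReal.measurable_log.comp ((measurable_const.sub hqm).div hqm)))
  have hQ : (ν.withDensity q) Set.univ = 1 := by
    rw [withDensity_apply _ MeasurableSet.univ, setLIntegral_univ, hlint q hqm]
    have : ∫⁻ t, (1 + invRatio t) * q t ∂L = m := by
      refine lintegral_congr_ae ?_
      filter_upwards [h.ae_invRatio_ne_top] with t ht using one_add_mul_one_sub_inv ht
    rw [this]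
    simp only [hq, hbot, add_top, ENNReal.inv_top, tsub_zero, mul_one]
    exact add_tsub_cancel_of_le hm1
  have hP : (ν.withDensity fun t => 1 - q t) Set.univ = 1 := by
    have := congrArg (fun m => m Set.univ) hL
    simp only [lossOf, pld, measure_univ] at this
    have hmm : Measurable fun t => ENNReal.log (likelihoodRatio (ν.withDensity fun t => 1 - q t)
        (ν.withDensity q) t) := ENNReal.measurable_log.comp (measurable_likelihoodRatio _ _)
    refine Eq.trans ?_ this.symm
    rw [Measure.map_apply hmm MeasurableSet.univ, Set.preimage_univ]
  rw [hL]
  exact ⟨EReal, inferInstance, _, _, ⟨hP⟩, ⟨hQ⟩, rfl⟩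

end Representation

/-! ### Quantile functions and ordered couplings. -/

section Quantile

/-- The uniform distribution on `(0, 1)`. -/
noncomputable def unif : Measure ℝ := volume.restrict (Set.Ioo 0 1)

instance isProbabilityMeasure_unif : IsProbabilityMeasure unif := ⟨by simp [unif]⟩

lemma ae_unif_mem : ∀ᵐ z ∂unif, z ∈ Set.Ioo (0 : ℝ) 1 := ae_restrict_mem measurableSet_Ioo

open Classical in
/-- The quantile function of a law on the real line. -/
noncomputable def quantile (μ : Measure ℝ) (z : ℝ) : ℝ :=
  if z ∈ Set.Ioo (0 : ℝ) 1 then sInf {x | z ≤ cdf μ x} else 0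

/-- Right-continuity of the cdf means that the infimum is attained. All other properties of the
quantile function follow from this Galois connection. -/
lemma quantile_le_iff (μ : Measure ℝ) {z : ℝ} (hz : z ∈ Set.Ioo (0 : ℝ) 1) (x : ℝ) :
    quantile μ z ≤ x ↔ z ≤ cdf μ x := by
  rw [quantile, if_pos hz]
  set S := {x | z ≤ cdf μ x} with hS
  have hne : S.Nonempty :=
    (((tendsto_cdf_atTop μ).eventually (lt_mem_nhds hz.2)).mono fun _ h => le_of_lt h).exists
  obtain ⟨y, hy⟩ := ((tendsto_cdf_atBot μ).eventually (gt_mem_nhds hz.1)).exists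
  have hbdd : BddBelow S := ⟨y, fun w hw => by
    by_contra! hlt
    exact absurd (hw.trans (monotone_cdf μ hlt.le)) (not_le.2 hy)⟩
  constructor
  · intro h
    have hright := ((cdf μ).right_continuous x).tendsto.mono_left
      (nhdsWithin_mono x Set.Ioi_subset_Ici_self)
    refine ge_of_tendsto hright ?_
    filter_upwards [self_mem_nhdsWithin] with w hw
    obtain ⟨s, hs, hsw⟩ := exists_lt_of_csInf_lt hne (h.trans_lt hw)
    exact (show z ≤ cdf μ s from hs).trans (monotone_cdf μ hsw.le)
  · exact fun h => csInf_le hbdd h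

lemma measurable_quantile (μ : Measure ℝ) : Measurable (quantile μ) := by
  refine measurable_of_Iic fun x => ?_
  have : quantile μ ⁻¹' Set.Iic x = (Set.Ioo 0 1 ∩ Set.Iic (cdf μ x)) ∪
      ((Set.Ioo (0 : ℝ) 1)ᶜ ∩ {_z | (0 : ℝ) ≤ x}) := by
    ext z
    by_cases hz : z ∈ Set.Ioo (0 : ℝ) 1
    · simp only [Set.mem_preimage, Set.mem_Iic, quantile_le_iff μ hz]
      simp [hz, -Set.mem_Ioo]
    · simp [quantile, hz, -Set.mem_Ioo]
  rw [this]
  exact (measurableSet_Ioo.inter measurableSet_Iic).union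
    (measurableSet_Ioo.compl.inter (MeasurableSet.const _))

lemma map_quantile (μ : Measure ℝ) [IsProbabilityMeasure μ] : unif.map (quantile μ) = μ := by
  have : IsProbabilityMeasure (unif.map (quantile μ)) :=
    Measure.isProbabilityMeasure_map (measurable_quantile μ).aemeasurable
  refine Measure.ext_of_Iic _ _ fun x => ?_
  rw [Measure.map_apply (measurable_quantile μ) measurableSet_Iic, ← ofReal_cdf μ x]
  have h : quantile μ ⁻¹' Set.Iic x ∩ Set.Ioo 0 1 = Set.Ioo 0 1 ∩ Set.Iic (cdf μ x) := by
    ext z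
    constructor
    · rintro ⟨h1, h2⟩
      exact ⟨h2, (quantile_le_iff μ h2 x).1 h1⟩
    · rintro ⟨h1, h2⟩
      exact ⟨(quantile_le_iff μ h1 x).2 h2, h1⟩
  rw [unif, Measure.restrict_apply (measurable_quantile μ measurableSet_Iic), h]
  have h0 := cdf_nonneg μ x
  have h1 := cdf_le_one μ x
  refine le_antisymm ?_ ?_
  · calc volume (Set.Ioo 0 1 ∩ Set.Iic (cdf μ x)) ≤ volume (Set.Ioc 0 (cdf μ x)) :=
        measure_mono fun z (hz : z ∈ Set.Ioo 0 1 ∩ _) => ⟨hz.1.1, hz.2⟩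
      _ = _ := by simp
  · calc ENNReal.ofReal (cdf μ x) = volume (Set.Ioo 0 (cdf μ x)) := by simp
      _ ≤ volume (Set.Ioo 0 1 ∩ Set.Iic (cdf μ x)) :=
        measure_mono fun z hz => ⟨⟨hz.1, hz.2.trans_le h1⟩, hz.2.le⟩

lemma quantile_mono (μ : Measure ℝ) : MonotoneOn (quantile μ) (Set.Ioo 0 1) := by
  intro y hy z hz hyz
  exact (quantile_le_iff μ hy _).2 (hyz.trans ((quantile_le_iff μ hz _).1 le_rfl))

lemma quantile_le_quantile {μ ν : Measure ℝ} [IsProbabilityMeasure μ] [IsProbabilityMeasure ν]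
    (h : ∀ x, ν (Set.Iic x) ≤ μ (Set.Iic x)) {z : ℝ} (hz : z ∈ Set.Ioo (0 : ℝ) 1) :
    quantile μ z ≤ quantile ν z := by
  refine (quantile_le_iff μ hz _).2 (((quantile_le_iff ν hz _).1 le_rfl).trans ?_)
  have := h (quantile ν z)
  rw [← ofReal_cdf, ← ofReal_cdf] at this
  exact (ENNReal.ofReal_le_ofReal_iff (cdf_nonneg _ _)).1 this

/-- Finite measures of equal mass, one stochastically dominated by the other, are images of a
multiple of the uniform distribution under ordered maps. -/
lemma exists_ordered_maps {α β : Measure ℝ} [IsFiniteMeasure α]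
    (hmass : α Set.univ = β Set.univ) (h : ∀ x, β (Set.Iic x) ≤ α (Set.Iic x)) :
    ∃ u v : ℝ → ℝ, Measurable u ∧ Measurable v ∧ α Set.univ • unif.map u = α ∧
      α Set.univ • unif.map v = β ∧ ∀ᵐ z ∂unif, u z ≤ v z := by
  set m := α Set.univ with hm
  have hmtop : m ≠ ∞ := measure_ne_top _ _
  by_cases h0 : m = 0
  · refine ⟨id, id, measurable_id, measurable_id, ?_, ?_, .of_forall fun _ => le_rfl⟩
    · rw [h0, zero_smul, eq_comm]
      exact Measure.measure_univ_eq_zero.1 h0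
    · rw [h0, zero_smul, eq_comm]
      exact Measure.measure_univ_eq_zero.1 (hmass ▸ h0)
  have hα : IsProbabilityMeasure (m⁻¹ • α) :=
    ⟨by rw [Measure.smul_apply, smul_eq_mul, ← hm, ENNReal.inv_mul_cancel h0 hmtop]⟩
  have hβ : IsProbabilityMeasure (m⁻¹ • β) :=
    ⟨by rw [Measure.smul_apply, smul_eq_mul, ← hmass, ENNReal.inv_mul_cancel h0 hmtop]⟩
  refine ⟨quantile (m⁻¹ • α), quantile (m⁻¹ • β), measurable_quantile _, measurable_quantile _,
    ?_, ?_, ?_⟩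
  · rw [map_quantile, smul_smul, ENNReal.mul_inv_cancel h0 hmtop, one_smul]
  · rw [map_quantile, smul_smul, ENNReal.mul_inv_cancel h0 hmtop, one_smul]
  · filter_upwards [ae_unif_mem] with z hz
    refine quantile_le_quantile (fun x => ?_) hz
    simp only [Measure.smul_apply, smul_eq_mul]
    exact mul_le_mul_right (h x) _

end Quantile

/-! ### The averaging coupling behind Blackwell's theorem. -/

section Coupling

/-- The image under `w` of the weight m / d(w) has density d · d⁻¹ ≤ 1, supported where d ≠ 0. This
bounds the mass that the coupling may move. -/
lemma map_withDensity_le_restrict {m : ℝ≥0∞} {w : ℝ → ℝ} (hw : Measurable w)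
    {W d : ℝ → ℝ≥0∞} (hd : Measurable d)
    (hmap : m • unif.map w = unif.withDensity d) (hW : ∀ᵐ z ∂unif, W z ≤ m * (d (w z))⁻¹) :
    (unif.withDensity W).map w ≤ unif.restrict {x | d x ≠ 0} := by
  have hS : MeasurableSet {x | d x ≠ 0} := (hd (measurableSet_singleton 0)).compl
  have hdi : ∀ A, MeasurableSet A → Measurable (A.indicator fun x => (d x)⁻¹) :=
    fun A hA => Measurable.indicator (f := fun x => (d x)⁻¹) hd.inv hA
  refine Measure.le_iff.2 fun A hA => ?_
  rw [Measure.map_apply hw hA, withDensity_apply _ (hw hA), ← lintegral_indicator (hw hA)]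
  calc ∫⁻ z, (w ⁻¹' A).indicator W z ∂unif
      ≤ ∫⁻ z, m * (A.indicator (fun x => (d x)⁻¹) (w z)) ∂unif := by
        refine lintegral_mono_ae ?_
        filter_upwards [hW] with z hz
        by_cases h : w z ∈ A
        · rwa [Set.indicator_of_mem (by exact h), Set.indicator_of_mem h]
        · rw [Set.indicator_of_notMem (by exact h)]; exact zero_le
    _ = ∫⁻ x, A.indicator (fun x => (d x)⁻¹) x ∂(m • unif.map w) := by
        rw [lintegral_smul_measure, lintegral_map (hdi A hA) hw, smul_eq_mul,
          lintegral_const_mul m (f := fun z => A.indicator (fun x => (d x)⁻¹) (w z))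
            ((hdi A hA).comp hw)]
    _ = ∫⁻ x, d x * A.indicator (fun x => (d x)⁻¹) x ∂unif := by
        rw [hmap, lintegral_withDensity_eq_lintegral_mul _ hd (hdi A hA)]
        rfl
    _ ≤ ∫⁻ x, (A ∩ {x | d x ≠ 0}).indicator 1 x ∂unif := by
        refine lintegral_mono fun x => ?_
        by_cases h : x ∈ A
        · by_cases h0 : d x = 0
          · simp [h0]
          · rw [Set.indicator_of_mem h, Set.indicator_of_mem (by exact ⟨h, h0⟩)]
            exact ENNReal.mul_inv_le_one _
        · simp [h]
    _ = _ := by rw [lintegral_indicator_one (hA.inter hS), Measure.restrict_apply hA]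

variable {g g' : ℝ → ℝ≥0∞}

lemma ae_map_withDensity {m : ℝ≥0∞} (hm : m ≠ 0) {w : ℝ → ℝ} (hw : Measurable w)
    {d : ℝ → ℝ≥0∞} (hd : Measurable d) (hmap : m • unif.map w = unif.withDensity d) :
    ∀ᵐ z ∂unif, w z ∈ Set.Ioo (0 : ℝ) 1 ∧ d (w z) ≠ 0 := by
  have h1 : ∀ᵐ x ∂(unif.withDensity d), x ∈ Set.Ioo (0 : ℝ) 1 ∧ d x ≠ 0 := by
    rw [ae_withDensity_iff hd]
    filter_upwards [ae_unif_mem] with x hx h using ⟨hx, h⟩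
  rw [← hmap, Measure.ae_ennreal_smul_measure_iff hm] at h1
  exact ae_of_ae_map hw.aemeasurable h1

/-- Monotone densities of which one has larger partial integrals are related by a coupling that
averages: given the second coordinate, the conditional mean of `g'` at the first is `g`. -/
lemma exists_averaging_coupling (hg : Measurable g) (hg' : Measurable g')
    (hgm : MonotoneOn g (Set.Ioo 0 1))
    (hg1 : ∀ x, g x ≤ 1) (hg1' : ∀ x, g' x ≤ 1)
    (hle : ∀ x, ∫⁻ y in Set.Iic x, g' y ∂unif ≤ ∫⁻ y in Set.Iic x, g y ∂unif)
    (heq : ∫⁻ y, g' y ∂unif = ∫⁻ y, g y ∂unif) :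
    ∃ π : Measure (ℝ × ℝ), π.fst = unif ∧ π.snd = unif ∧ ∀ A, MeasurableSet A →
      ∫⁻ p, g' p.1 * A.indicator 1 p.2 ∂π = ∫⁻ y in A, g y ∂unif := by
  -- `α` is what averaging must add to `g'`, and `β` what it must remove, in order to reach `g`.
  set α := unif.withDensity (fun x => g x - g' x) with hα
  set β := unif.withDensity (fun x => g' x - g x) with hβ
  have hdα : Measurable fun x => g x - g' x := hg.sub hg'
  have hdβ : Measurable fun x => g' x - g x := hg'.sub hg
  have hfα : IsFiniteMeasure α := isFiniteMeasure_withDensity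
    (ne_top_of_le_ne_top ENNReal.one_ne_top ((lintegral_mono fun x =>
      tsub_le_self.trans (hg1 x)).trans (by simp)))
  have hfβ : IsFiniteMeasure β := isFiniteMeasure_withDensity
    (ne_top_of_le_ne_top ENNReal.one_ne_top ((lintegral_mono fun x =>
      tsub_le_self.trans (hg1' x)).trans (by simp)))
  have hne' : ∀ x, g' x ≠ ∞ := fun x => ne_top_of_le_ne_top ENNReal.one_ne_top (hg1' x)
  have hmax : ∀ x, g' x + (g x - g' x) = g x + (g' x - g x) := fun x => by
    rw [add_tsub_eq_max, add_tsub_eq_max, max_comm]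
  have hbal : ∀ A, MeasurableSet A → ∫⁻ y in A, g' y ∂unif + α A = ∫⁻ y in A, g y ∂unif + β A := by
    intro A hA
    rw [hα, hβ, withDensity_apply _ hA, withDensity_apply _ hA, ← lintegral_add_left hg',
      ← lintegral_add_left hg]
    exact lintegral_congr hmax
  have hlefin : ∀ A, ∫⁻ y in A, g y ∂unif ≠ ∞ := fun A =>
    ne_top_of_le_ne_top ENNReal.one_ne_top ((setLIntegral_le_lintegral _ _).trans
      ((lintegral_mono hg1).trans (by simp)))
  have hmass : α Set.univ = β Set.univ := by
    have := hbal Set.univ MeasurableSet.univ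
    rw [setLIntegral_univ, setLIntegral_univ, heq] at this
    refine (ENNReal.add_right_inj ?_).1 this
    simpa using hlefin Set.univ
  have hdom : ∀ x, β (Set.Iic x) ≤ α (Set.Iic x) := by
    intro x
    refine (ENNReal.add_le_add_iff_left (hlefin (Set.Iic x))).1 ?_
    rw [← hbal _ measurableSet_Iic]
    exact add_le_add (hle x) le_rfl
  -- By the assumption on partial integrals, the deficit `α` lies to the left of the excess `β`:
  -- each deficit point u z is paired with an excess point v z ≥ u z, and monotonicity of `g` gives
  -- g'(u) < g(u) ≤ g(v) < g'(v).
  obtain ⟨u, v, hu, hv, hmu, hmv, huv⟩ := exists_ordered_maps hmass hdom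
  set m := α Set.univ with hm
  have hfacts : m ≠ 0 → ∀ᵐ z ∂unif, g' (u z) < g (u z) ∧ g (u z) ≤ g (v z) ∧
      g (v z) < g' (v z) := by
    intro h0
    filter_upwards [ae_map_withDensity h0 hu hdα hmu, ae_map_withDensity h0 hv hdβ hmv, huv]
      with z h1 h2 h3
    exact ⟨tsub_pos_iff_lt.1 (pos_iff_ne_zero.2 h1.2), hgm h1.1 h2.1 h3,
      tsub_pos_iff_lt.1 (pos_iff_ne_zero.2 h2.2)⟩
  -- Exchanging mass W between u z and v z changes the integral of `g'` at either end by W (g'(v) -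
  -- g'(u)) = m, just what `α` and `β` require.
  set W : ℝ → ℝ≥0∞ := fun z => m * (g' (v z) - g' (u z))⁻¹ with hW
  have hWm : Measurable W := measurable_const.mul ((hg'.comp hv).sub (hg'.comp hu)).inv
  have hWu : ∀ᵐ z ∂unif, W z ≤ m * (g (u z) - g' (u z))⁻¹ := by
    by_cases h0 : m = 0
    · exact .of_forall fun z => by simp [hW, h0]
    filter_upwards [hfacts h0] with z ⟨h1, h2, h3⟩
    exact mul_le_mul_right (ENNReal.inv_le_inv.2 (tsub_le_tsub_right (h2.trans h3.le) _)) _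
  have hWv : ∀ᵐ z ∂unif, W z ≤ m * (g' (v z) - g (v z))⁻¹ := by
    by_cases h0 : m = 0
    · exact .of_forall fun z => by simp [hW, h0]
    filter_upwards [hfacts h0] with z ⟨h1, h2, h3⟩
    exact mul_le_mul_right (ENNReal.inv_le_inv.2 (tsub_le_tsub_left (h1.le.trans h2) _)) _
  have hWd : ∀ᵐ z ∂unif, W z * (g' (v z) - g' (u z)) = m ∧ g' (u z) ≤ g' (v z) ∨ m = 0 := by
    by_cases h0 : m = 0
    · exact .of_forall fun z => Or.inr h0
    filter_upwards [hfacts h0] with z ⟨h1, h2, h3⟩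
    have hlt : g' (u z) < g' (v z) := h1.trans_le (h2.trans h3.le)
    refine Or.inl ⟨?_, hlt.le⟩
    rw [hW, mul_assoc, ENNReal.inv_mul_cancel (tsub_pos_iff_lt.2 hlt).ne'
      (ne_top_of_le_ne_top (hne' _) tsub_le_self), mul_one]
  set ρ := unif.withDensity W with hρ
  set σ := ρ.map u + ρ.map v with hσ
  -- There is enough mass to exchange: `g'` differs more between the two ends than it differs from
  -- `g` at either end, and the two ends lie in disjoint sets.
  have hσle : σ ≤ unif := by
    have h1 := map_withDensity_le_restrict hu hdα hmu hWu
    have h2 := map_withDensity_le_restrict hv hdβ hmv hWv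
    have hdisj : Disjoint {x | g x - g' x ≠ 0} {x | g' x - g x ≠ 0} := by
      rw [Set.disjoint_left]
      intro x h1 h2
      exact lt_asymm (tsub_pos_iff_lt.1 (pos_iff_ne_zero.2 h1))
        (tsub_pos_iff_lt.1 (pos_iff_ne_zero.2 h2))
    refine (add_le_add h1 h2).trans ?_
    rw [← Measure.restrict_union hdisj (hdβ (measurableSet_singleton 0)).compl]
    exact Measure.restrict_le_self
  have hfσ : IsFiniteMeasure σ := isFiniteMeasure_of_le unif hσle
  set κ := unif - σ with hκ
  have hκσ : κ + σ = unif := Measure.sub_add_cancel_of_le hσle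
  have hdiag : Measurable fun x : ℝ => (x, x) := measurable_id.prodMk measurable_id
  have huvm : Measurable fun z => (u z, v z) := hu.prodMk hv
  have hvum : Measurable fun z => (v z, u z) := hv.prodMk hu
  -- Moving `ρ` in both directions keeps both marginals equal; the remaining mass `κ` stays on the
  -- diagonal.
  refine ⟨κ.map (fun x => (x, x)) + (ρ.map (fun z => (u z, v z)) + ρ.map fun z => (v z, u z)),
    ?_, ?_, fun A hA => ?_⟩
  · rw [Measure.fst, Measure.map_add _ _ measurable_fst, Measure.map_add _ _ measurable_fst,
      Measure.map_map measurable_fst hdiag, Measure.map_map measurable_fst huvm,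
      Measure.map_map measurable_fst hvum]
    conv_rhs => rw [← hκσ, ← Measure.map_id (μ := κ)]
    rfl
  · rw [Measure.snd, Measure.map_add _ _ measurable_snd, Measure.map_add _ _ measurable_snd,
      Measure.map_map measurable_snd hdiag, Measure.map_map measurable_snd huvm,
      Measure.map_map measurable_snd hvum, add_comm (Measure.map _ ρ)]
    conv_rhs => rw [← hκσ, ← Measure.map_id (μ := κ)]
    rfl
  · set h : ℝ → ℝ≥0∞ := A.indicator 1 with hh
    have hhm : Measurable h := measurable_one.indicator hA
    have hF : Measurable fun p : ℝ × ℝ => g' p.1 * h p.2 :=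
      (hg'.comp measurable_fst).mul (hhm.comp measurable_snd)
    have hswap : ∀ (w₁ w₂ w : ℝ → ℝ), Measurable w₁ → Measurable w₂ → Measurable w →
        ∀ γ : Measure ℝ, m • unif.map w = γ →
        (∀ z, g' (w₁ z) + (g' (v z) - g' (u z)) = g' (w₂ z) ∨ ¬ g' (u z) ≤ g' (v z)) →
        ∫⁻ z, g' (w₂ z) * h (w z) ∂ρ = ∫⁻ z, g' (w₁ z) * h (w z) ∂ρ + ∫⁻ x, h x ∂γ := by
      intro w₁ w₂ w hw₁ hw₂ hw γ hγ hadd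
      have hhw : Measurable fun z => h (w z) := hhm.comp hw
      rw [hρ, lintegral_withDensity_eq_lintegral_mul (g := fun z => g' (w₂ z) * h (w z)) _ hWm
          ((hg'.comp hw₂).mul hhw),
        lintegral_withDensity_eq_lintegral_mul (g := fun z => g' (w₁ z) * h (w z)) _ hWm
          ((hg'.comp hw₁).mul hhw), ← hγ,
        lintegral_smul_measure, lintegral_map hhm hw, smul_eq_mul, ← lintegral_const_mul _ hhw,
        ← lintegral_add_left (f := W * fun z => g' (w₁ z) * h (w z))
          (hWm.mul ((hg'.comp hw₁).mul hhw))]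
      refine lintegral_congr_ae ?_
      filter_upwards [hWd] with z hz
      simp only [Pi.mul_apply]
      rcases hz with ⟨hz1, hz2⟩ | h0
      · rw [← (hadd z).resolve_right (not_not.2 hz2), add_mul, mul_add, ← mul_assoc (W z) (_ - _),
          hz1]
      · simp [hW, h0]
    have e1 := hswap u v v hu hv hv β hmv fun z => by
      by_cases hz : g' (u z) ≤ g' (v z)
      exacts [Or.inl (add_tsub_cancel_of_le hz), Or.inr hz]
    have e2 := hswap u v u hu hv hu α hmu fun z => by
      by_cases hz : g' (u z) ≤ g' (v z)
      exacts [Or.inl (add_tsub_cancel_of_le hz), Or.inr hz]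
    have hghm : Measurable fun x => g' x * h x := hg'.mul hhm
    have e3 : ∫⁻ x, g' x * h x ∂unif = ∫⁻ x, g' x * h x ∂κ +
        (∫⁻ z, g' (u z) * h (u z) ∂ρ + ∫⁻ z, g' (v z) * h (v z) ∂ρ) := by
      conv_lhs => rw [← hκσ]
      rw [lintegral_add_measure, hσ, lintegral_add_measure, lintegral_map hghm hu,
        lintegral_map hghm hv]
    have hint : ∀ f : ℝ → ℝ≥0∞, ∫⁻ x, f x * h x ∂unif = ∫⁻ x in A, f x ∂unif := by
      intro f
      rw [← lintegral_indicator hA]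
      refine lintegral_congr fun x => ?_
      by_cases hx : x ∈ A <;> simp [hh, hx]
    have hhA : ∀ γ : Measure ℝ, ∫⁻ x, h x ∂γ = γ A := fun γ => lintegral_indicator_one hA
    rw [lintegral_add_measure, lintegral_add_measure, lintegral_map hF hdiag,
      lintegral_map hF huvm, lintegral_map hF hvum]
    simp only
    refine (ENNReal.add_left_inj (measure_ne_top β A)).1 ?_
    rw [← hbal A hA, ← hint, e3, e1, e2, hhA, hhA]
    ring

end Coupling

/-! ### Blackwell's theorem: the hockey-stick order implies the Blackwell order. -/

section Blackwell

instance isFiniteMeasure_two_smul {Ω : Type*} [MeasurableSpace Ω] (μ : Measure Ω)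
    [IsFiniteMeasure μ] : IsFiniteMeasure ((2 : ℝ≥0∞) • μ) :=
  μ.smul_finite ENNReal.ofNat_ne_top

/-- Take the threshold c = g'(x). As `g'` is monotone, (c - g')⁺ lives on y ≤ x and equals c - g'
there, while for `g` the bound c ≤ (c - g)⁺ + g is enough. -/
lemma lintegral_tsub_unif {g g' : ℝ → ℝ≥0∞} (hg : Measurable g) (hg' : Measurable g')
    (hgm' : MonotoneOn g' (Set.Ioo 0 1)) (hg1' : ∀ x, g' x ≤ 1)
    (hle : ∀ c ≤ 1, ∫⁻ x, (c - g x) ∂unif ≤ ∫⁻ x, (c - g' x) ∂unif)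
    (heq : ∫⁻ x, g' x ∂unif = ∫⁻ x, g x ∂unif) (x : ℝ) :
    ∫⁻ y in Set.Iic x, g' y ∂unif ≤ ∫⁻ y in Set.Iic x, g y ∂unif := by
  by_cases hx : x ∈ Set.Ioo (0 : ℝ) 1
  · set c := g' x with hc
    have hctop : c ≠ ∞ := ne_top_of_le_ne_top ENNReal.one_ne_top (hg1' x)
    have hsplit : ∫⁻ y, (c - g' y) ∂unif = ∫⁻ y in Set.Iic x, (c - g' y) ∂unif := by
      rw [← lintegral_indicator measurableSet_Iic]
      refine lintegral_congr_ae ?_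
      filter_upwards [ae_unif_mem] with y hy
      by_cases hyx : y ≤ x
      · rw [Set.indicator_of_mem (by exact hyx)]
      · rw [Set.indicator_of_notMem (by exact hyx)]
        exact tsub_eq_zero_of_le (hgm' hx hy (not_le.1 hyx).le)
    have h1 : ∫⁻ y in Set.Iic x, (c - g' y) ∂unif + ∫⁻ y in Set.Iic x, g' y ∂unif =
        ∫⁻ _ in Set.Iic x, c ∂unif := by
      rw [← lintegral_add_right _ hg', ← lintegral_indicator measurableSet_Iic,
        ← lintegral_indicator measurableSet_Iic]
      refine lintegral_congr_ae ?_
      filter_upwards [ae_unif_mem] with y hy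
      by_cases hyx : y ≤ x
      · rw [Set.indicator_of_mem (by exact hyx), Set.indicator_of_mem (by exact hyx)]
        exact tsub_add_cancel_of_le (hgm' hy hx hyx)
      · rw [Set.indicator_of_notMem (by exact hyx), Set.indicator_of_notMem (by exact hyx)]
    have hfin : ∫⁻ y in Set.Iic x, (c - g' y) ∂unif ≠ ∞ := by
      refine ne_top_of_le_ne_top ?_ (le_self_add.trans h1.le)
      rw [setLIntegral_const]
      exact ENNReal.mul_ne_top hctop (measure_ne_top _ _)
    refine (ENNReal.add_le_add_iff_left hfin).1 ?_
    calc _ = ∫⁻ _ in Set.Iic x, c ∂unif := h1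
      _ ≤ ∫⁻ y in Set.Iic x, ((c - g y) + g y) ∂unif := lintegral_mono fun y => le_tsub_add
      _ = ∫⁻ y in Set.Iic x, (c - g y) ∂unif + ∫⁻ y in Set.Iic x, g y ∂unif :=
        lintegral_add_right _ hg
      _ ≤ _ := add_le_add ((setLIntegral_le_lintegral _ _).trans
        ((hle c (hg1' x)).trans hsplit.le)) le_rfl
  · rw [Set.mem_Ioo, not_and_or, not_lt, not_lt] at hx
    rcases hx with hx | hx
    · have : unif.restrict (Set.Iic x) = 0 := by
        rw [Measure.restrict_eq_zero, unif, Measure.restrict_apply measurableSet_Iic]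
        rw [show Set.Iic x ∩ Set.Ioo 0 1 = ∅ from ?_, measure_empty]
        ext y
        simp only [Set.mem_inter_iff, Set.mem_Iic, Set.mem_Ioo, Set.mem_empty_iff_false,
          iff_false]
        rintro ⟨h1, h2, -⟩
        linarith
      simp [this]
    · have : unif.restrict (Set.Iic x) = unif := by
        refine Measure.restrict_eq_self_of_ae_mem ?_
        filter_upwards [ae_unif_mem] with y hy using hy.2.le.trans hx
      rw [this, heq]

/-- The kernel is the conditional law of the second coordinate given the first. It sends `g'` to `g`
by averaging and `unif` to `unif` by the marginals, hence 1 - g' to 1 - g. -/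
lemma blackwellLE_of_coupling {g g' : ℝ → ℝ≥0∞} (hg : Measurable g) (hg' : Measurable g')
    (hg1 : ∀ x, g x ≤ 1) (hg1' : ∀ x, g' x ≤ 1) {π : Measure (ℝ × ℝ)} (hfst : π.fst = unif)
    (hsnd : π.snd = unif) (hπ : ∀ A, MeasurableSet A →
      ∫⁻ p, g' p.1 * A.indicator 1 p.2 ∂π = ∫⁻ y in A, g y ∂unif) :
    BlackwellLE (((2 : ℝ≥0∞) • unif).withDensity fun x => 1 - g x)
      (((2 : ℝ≥0∞) • unif).withDensity g) (((2 : ℝ≥0∞) • unif).withDensity fun x => 1 - g' x)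
      (((2 : ℝ≥0∞) • unif).withDensity g') := by
  have hfin : IsFiniteMeasure π := ⟨by
    rw [← Measure.fst_univ, hfst]; exact measure_lt_top _ _⟩
  have hdis : unif ⊗ₘ π.condKernel = π := hfst ▸ π.disintegrate π.condKernel
  have hbind : ∀ f : ℝ → ℝ≥0∞, Measurable f → ∀ A, MeasurableSet A →
      ((((2 : ℝ≥0∞) • unif).withDensity f).bind π.condKernel) A =
        2 * ∫⁻ p, f p.1 * A.indicator 1 p.2 ∂π := by
    intro f hf A hA
    have hm : Measurable fun p : ℝ × ℝ => f p.1 * A.indicator (1 : ℝ → ℝ≥0∞) p.2 :=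
      (hf.comp measurable_fst).mul ((measurable_one.indicator hA).comp measurable_snd)
    rw [Measure.bind_apply hA π.condKernel.aemeasurable,
      lintegral_withDensity_eq_lintegral_mul _ hf (π.condKernel.measurable_coe hA),
      lintegral_smul_measure, smul_eq_mul]
    conv_rhs => rw [← hdis, Measure.lintegral_compProd hm]
    congr 1
    refine lintegral_congr fun x => ?_
    simp only
    rw [lintegral_const_mul (f x) (f := fun y => A.indicator (1 : ℝ → ℝ≥0∞) y)
      (measurable_one.indicator hA), lintegral_indicator_one hA]
    rfl
  have hden : ∀ f : ℝ → ℝ≥0∞, ∀ A, MeasurableSet A →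
      (((2 : ℝ≥0∞) • unif).withDensity f) A = 2 * ∫⁻ y in A, f y ∂unif := by
    intro f A hA
    rw [withDensity_apply _ hA, Measure.restrict_smul, lintegral_smul_measure, smul_eq_mul]
  refine ⟨π.condKernel, inferInstance, Measure.ext fun A hA => ?_, Measure.ext fun A hA => ?_⟩
  · rw [hbind (fun x => 1 - g' x) (measurable_const.sub hg') A hA, hden _ A hA]
    congr 1
    have h1m : Measurable (A.indicator (1 : ℝ → ℝ≥0∞)) := measurable_one.indicator hA
    have hm : Measurable fun p : ℝ × ℝ => g' p.1 * A.indicator (1 : ℝ → ℝ≥0∞) p.2 :=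
      (hg'.comp measurable_fst).mul (h1m.comp measurable_snd)
    have h1 : ∫⁻ p, (1 - g' p.1) * A.indicator 1 p.2 ∂π + ∫⁻ y in A, g y ∂unif = unif A := by
      rw [← hπ A hA, ← lintegral_add_right _ hm]
      calc ∫⁻ p, ((1 - g' p.1) * A.indicator 1 p.2 + g' p.1 * A.indicator 1 p.2) ∂π
          = ∫⁻ p, A.indicator 1 p.2 ∂π := by
            refine lintegral_congr fun p => ?_
            rw [← add_mul, tsub_add_cancel_of_le (hg1' _), one_mul]
        _ = ∫⁻ y, A.indicator 1 y ∂π.snd := (lintegral_map h1m measurable_snd).symm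
        _ = unif A := by rw [hsnd, lintegral_indicator_one hA]
    have h2 : ∫⁻ y in A, (1 - g y) ∂unif + ∫⁻ y in A, g y ∂unif = unif A := by
      rw [← lintegral_add_right _ hg, ← setLIntegral_one]
      exact lintegral_congr fun y => tsub_add_cancel_of_le (hg1 y)
    refine (ENNReal.add_left_inj ?_).1 (h2.trans h1.symm)
    exact ne_top_of_le_ne_top (measure_ne_top unif A) (h2 ▸ le_add_self)
  · rw [hbind _ hg' A hA, hden _ A hA, hπ A hA]

/-- The quantile function of a law on `[0, 1]`, as a density. -/
noncomputable def quantileDensity (μ : Measure ℝ) (z : ℝ) : ℝ≥0∞ :=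
  ENNReal.ofReal (min (quantile μ z) 1)

lemma measurable_quantileDensity (μ : Measure ℝ) : Measurable (quantileDensity μ) :=
  ((measurable_quantile μ).min measurable_const).ennreal_ofReal

lemma quantileDensity_le_one (μ : Measure ℝ) (z : ℝ) : quantileDensity μ z ≤ 1 :=
  ENNReal.ofReal_le_one.2 (min_le_right _ _)

lemma quantileDensity_mono (μ : Measure ℝ) :
    MonotoneOn (quantileDensity μ) (Set.Ioo 0 1) := fun _ hy _ hz h =>
  ENNReal.ofReal_le_ofReal (min_le_min_right _ (quantile_mono μ hy hz h))

/-- The cap at 1 serves only to bound the density at every point; it is inactive almost everywhere.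
-/
lemma IsCenteredLaw.ae_quantileDensity {μ : Measure ℝ} (h : IsCenteredLaw μ) :
    quantileDensity μ =ᵐ[unif] fun z => ENNReal.ofReal (quantile μ z) := by
  have := h.prob
  have h1 := h.ae_mem
  rw [← map_quantile μ] at h1
  filter_upwards [ae_of_ae_map (measurable_quantile μ).aemeasurable h1] with z hz
  rw [quantileDensity, min_eq_left hz.2]

lemma IsCenteredLaw.lintegral_quantileDensity {μ : Measure ℝ} (h : IsCenteredLaw μ) :
    2 * ∫⁻ z, quantileDensity μ z ∂unif = 1 := by
  have := h.prob
  rw [lintegral_congr_ae h.ae_quantileDensity,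
    ← lintegral_map ENNReal.measurable_ofReal (measurable_quantile μ), map_quantile,
    h.two_mul_lintegral]

/-- This puts all pairs over one uniform measure with monotone densities, as the coupling needs. -/
lemma IsCenteredLaw.lossOf_quantileDensity {μ : Measure ℝ} (h : IsCenteredLaw μ) :
    lossOf ((2 : ℝ≥0∞) • μ) ENNReal.ofReal = lossOf ((2 : ℝ≥0∞) • unif) (quantileDensity μ) := by
  have := h.prob
  have hmap : ((2 : ℝ≥0∞) • unif).map (quantile μ) = (2 : ℝ≥0∞) • μ := by
    rw [Measure.map_smul, map_quantile]
  have h1 := h.ae_le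
  rw [← hmap] at h1
  have h2 := lossOf_map ((2 : ℝ≥0∞) • unif) (measurable_quantile μ) ENNReal.measurable_ofReal h1
  rw [← hmap, h2]
  exact lossOf_congr _ (Measure.ae_smul_measure h.ae_quantileDensity.symm _)

/-- Blackwell's theorem for dichotomies. -/
theorem HockeyStickLE.pldLE {L L' : Measure EReal} (hL : IsPLD L) (hL' : IsPLD L')
    (h : HockeyStickLE L L') : PLDLE L L' := by
  obtain ⟨μ, hμ, rfl⟩ := hL.exists_isCenteredLaw
  obtain ⟨μ', hμ', rfl⟩ := hL'.exists_isCenteredLaw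
  have hprob : ∀ {μ : Measure ℝ}, IsCenteredLaw μ →
      IsProbabilityMeasure (((2 : ℝ≥0∞) • unif).withDensity fun x => 1 - quantileDensity μ x) ∧
      IsProbabilityMeasure (((2 : ℝ≥0∞) • unif).withDensity (quantileDensity μ)) := by
    intro μ hμ
    have h1 : (((2 : ℝ≥0∞) • unif).withDensity (quantileDensity μ)) Set.univ = 1 := by
      rw [withDensity_apply _ MeasurableSet.univ, setLIntegral_univ, lintegral_smul_measure,
        smul_eq_mul, hμ.lintegral_quantileDensity]
    refine ⟨⟨?_⟩, ⟨h1⟩⟩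
    have hs := congrArg (fun m => m Set.univ) (withDensity_add_withDensity_one_sub
      ((2 : ℝ≥0∞) • unif) (measurable_quantileDensity μ)
      (.of_forall (quantileDensity_le_one μ)))
    simp only [Measure.add_apply, h1, Measure.smul_apply, measure_univ, smul_eq_mul,
      mul_one] at hs
    exact (ENNReal.add_left_inj ENNReal.one_ne_top).1 (hs.trans one_add_one_eq_two.symm)
  rw [hμ.lossOf_quantileDensity, hμ'.lossOf_quantileDensity] at h ⊢
  have hle : ∀ c ≤ 1, ∫⁻ x, (c - quantileDensity μ x) ∂unif ≤
      ∫⁻ x, (c - quantileDensity μ' x) ∂unif := by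
    intro c hc
    have := h c (1 - c) (ne_top_of_le_ne_top ENNReal.one_ne_top hc)
      (ne_top_of_le_ne_top ENNReal.one_ne_top tsub_le_self)
    rw [hockeyStick_lossOf_one_sub _ (measurable_quantileDensity μ)
      (.of_forall (quantileDensity_le_one μ)) hc,
      hockeyStick_lossOf_one_sub _ (measurable_quantileDensity μ')
      (.of_forall (quantileDensity_le_one μ')) hc, lintegral_smul_measure,
      lintegral_smul_measure, smul_eq_mul, smul_eq_mul] at this
    exact (ENNReal.mul_le_mul_iff_right (by simp) (by simp)).1 this
  have heq : ∫⁻ x, quantileDensity μ' x ∂unif = ∫⁻ x, quantileDensity μ x ∂unif :=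
    (ENNReal.mul_right_inj (by simp) (by simp)).1
      (hμ'.lintegral_quantileDensity.trans hμ.lintegral_quantileDensity.symm)
  obtain ⟨π, h1, h2, h3⟩ := exists_averaging_coupling (measurable_quantileDensity μ)
    (measurable_quantileDensity μ') (quantileDensity_mono μ) (quantileDensity_le_one μ)
    (quantileDensity_le_one μ') (lintegral_tsub_unif (measurable_quantileDensity μ)
      (measurable_quantileDensity μ') (quantileDensity_mono μ') (quantileDensity_le_one μ')
      hle heq) heq
  exact ⟨ℝ, inferInstance, _, _, ℝ, inferInstance, _, _, (hprob hμ).1, (hprob hμ).2,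
    (hprob hμ').1, (hprob hμ').2, rfl, rfl,
    blackwellLE_of_coupling (measurable_quantileDensity μ) (measurable_quantileDensity μ')
      (quantileDensity_le_one μ) (quantileDensity_le_one μ') h1 h2 h3⟩

end Blackwell

/-! ### Suprema of PLDs via convex partial moments. -/

section Suprema

/-- Both sides are the product measure of the region x ≤ t < c. -/
lemma lintegral_ofReal_sub_eq (S : Measure ℝ) [IsProbabilityMeasure S] (c : ℝ) :
    ∫⁻ x, ENNReal.ofReal (c - x) ∂S = ∫⁻ t in Set.Iio c, S (Set.Iic t) := by
  have hE : MeasurableSet {p : ℝ × ℝ | p.1 ≤ p.2 ∧ p.2 < c} :=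
    (measurableSet_le measurable_fst measurable_snd).inter
      (measurableSet_lt measurable_snd measurable_const)
  have h1 := Measure.prod_apply (μ := S) (ν := volume) hE
  have h2 := Measure.prod_apply_symm (μ := S) (ν := volume) hE
  rw [← lintegral_indicator measurableSet_Iio]
  refine Eq.trans ?_ ((h1.symm.trans h2).trans ?_)
  · refine lintegral_congr fun x => ?_
    rw [← Real.volume_Ico]
    rfl
  · refine lintegral_congr fun t => ?_
    by_cases ht : t < c
    · rw [Set.indicator_of_mem (by exact ht)]
      congr 1
      ext x
      simp [ht]
    · rw [Set.indicator_of_notMem (by exact ht)]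
      simp [ht]

/-- A convex function with the asymptotics of the partial first moments of a centered law is the
partial first moment of a centered law. -/
lemma exists_isCenteredLaw_of_convexOn {ψ : ℝ → ℝ} (hψ : ConvexOn ℝ Set.univ ψ)
    (h0 : ∀ c ≤ 0, ψ c = 0) (h1 : ∀ c, 1 ≤ c → ψ c = c - 1 / 2) :
    ∃ S : Measure ℝ, IsCenteredLaw S ∧ ∀ c ∈ Set.Icc (0 : ℝ) 1,
      ∫⁻ x, ENNReal.ofReal (c - x) ∂S = ENNReal.ofReal (ψ c) := by
  -- The right derivative of ψ is the cdf sought, up to a right-continuous modification on a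
  -- countable set.
  set F : ℝ → ℝ := fun x => derivWithin ψ (Set.Ioi x) x with hF
  have hderiv : ∀ x, HasDerivWithinAt ψ (F x) (Set.Ioi x) x := fun x =>
    hψ.hasDerivWithinAt_rightDeriv_of_mem_interior (by simp)
  have hFm : Monotone F := by
    have := hψ.monotoneOn_rightDeriv
    rwa [interior_univ, monotoneOn_univ] at this
  have hF0 : ∀ x < 0, F x = 0 := by
    intro x hx
    have : HasDerivWithinAt ψ 0 (Set.Ioi x) x := by
      refine ((hasDerivAt_const x (0 : ℝ)).congr_of_eventuallyEq ?_).hasDerivWithinAt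
      filter_upwards [Iio_mem_nhds hx] with y hy using h0 y (le_of_lt hy)
    exact this.derivWithin (uniqueDiffWithinAt_Ioi x)
  have hF1 : ∀ x, 1 ≤ x → F x = 1 := by
    intro x hx
    have : HasDerivWithinAt ψ 1 (Set.Ioi x) x := by
      refine ((hasDerivAt_id x).sub_const (1 / 2)).hasDerivWithinAt.congr (fun y hy => ?_) ?_
      · exact h1 y (hx.trans (le_of_lt hy))
      · exact h1 x hx
    exact this.derivWithin (uniqueDiffWithinAt_Ioi x)
  set G := hFm.stieltjesFunction with hG
  have hG0 : ∀ x < 0, G x = 0 := by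
    intro x hx
    rw [hFm.stieltjesFunction_eq]
    refine rightLim_eq_of_tendsto (tendsto_const_nhds.congr' ?_)
    filter_upwards [mem_nhdsWithin_of_mem_nhds (Iio_mem_nhds hx)] with y hy using (hF0 y hy).symm
  have hG1 : ∀ x, 1 ≤ x → G x = 1 := by
    intro x hx
    rw [hFm.stieltjesFunction_eq]
    refine rightLim_eq_of_tendsto (tendsto_const_nhds.congr' ?_)
    filter_upwards [self_mem_nhdsWithin] with y hy using (hF1 y (hx.trans (le_of_lt hy))).symm
  have hbot : Filter.Tendsto G Filter.atBot (nhds 0) := by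
    refine tendsto_const_nhds.congr' ?_
    filter_upwards [Filter.Iio_mem_atBot 0] with x hx using (hG0 x hx).symm
  have htop : Filter.Tendsto G Filter.atTop (nhds 1) := by
    refine tendsto_const_nhds.congr' ?_
    filter_upwards [Filter.Ici_mem_atTop 1] with x hx using (hG1 x hx).symm
  have hprob : IsProbabilityMeasure G.measure := G.isProbabilityMeasure hbot htop
  have hmem : ∀ᵐ x ∂G.measure, x ∈ Set.Icc (0 : ℝ) 1 := by
    have ha : ∀ᵐ x ∂G.measure, 0 ≤ x := by
      rw [ae_iff]
      have : {x : ℝ | ¬ 0 ≤ x} = Set.Iio 0 := by ext; simp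
      rw [this, G.measure_Iio hbot, leftLim_eq_of_tendsto (y := 0), sub_zero, ENNReal.ofReal_zero]
      refine tendsto_const_nhds.congr' ?_
      filter_upwards [self_mem_nhdsWithin] with y hy using (hG0 y hy).symm
    have hb : ∀ᵐ x ∂G.measure, x ≤ 1 := by
      refine (mem_ae_iff_prob_eq_one measurableSet_Iic).2 ?_
      rw [G.measure_Iic hbot, hG1 1 le_rfl, sub_zero, ENNReal.ofReal_one]
    filter_upwards [ha, hb] with x h1 h2 using ⟨h1, h2⟩
  have hψ0 : ∀ c, ∫ t in (0 : ℝ)..c, F t = ψ c := by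
    intro c
    have hcont : ContinuousOn ψ (Set.uIcc 0 c) :=
      (hψ.continuousOn isOpen_univ).mono (Set.subset_univ _)
    rw [intervalIntegral.integral_eq_sub_of_hasDeriv_right hcont (fun x _ => hderiv x)
      hFm.intervalIntegrable, h0 0 le_rfl, sub_zero]
  have hae : ∀ᵐ t, G t = F t := by
    have : ∀ᵐ t, ContinuousAt F t := by
      rw [ae_iff]
      exact hFm.countable_not_continuousAt.measure_zero _
    filter_upwards [this] with t ht
    rw [hFm.stieltjesFunction_eq]
    exact ht.continuousWithinAt.rightLim_eq
  have hφ : ∀ c ∈ Set.Icc (0 : ℝ) 1,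
      ∫⁻ x, ENNReal.ofReal (c - x) ∂G.measure = ENNReal.ofReal (ψ c) := by
    intro c hc
    rw [lintegral_ofReal_sub_eq, ← hψ0 c, intervalIntegral.integral_of_le hc.1,
      ofReal_integral_eq_lintegral_ofReal hFm.intervalIntegrable.1, ← lintegral_indicator
      measurableSet_Iio, ← lintegral_indicator measurableSet_Ioc]
    · refine lintegral_congr_ae ?_
      have hne : ∀ y : ℝ, ∀ᵐ t : ℝ, t ≠ y := fun y => by simp [ae_iff]
      filter_upwards [hae, hne 0, hne c] with t ht h0 hc'
      rcases lt_or_gt_of_ne h0 with h | h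
      · rw [Set.indicator_of_notMem (s := Set.Ioc 0 c) (fun h' => absurd h'.1 h.not_gt)]
        by_cases htc : t < c
        · rw [Set.indicator_of_mem (by exact htc), G.measure_Iic hbot, hG0 t h]
          simp
        · rw [Set.indicator_of_notMem (by exact htc)]
      · rcases lt_or_gt_of_ne hc' with h' | h'
        · rw [Set.indicator_of_mem (by exact h'), Set.indicator_of_mem (by exact ⟨h, h'.le⟩),
            G.measure_Iic hbot, ht, sub_zero]
        · rw [Set.indicator_of_notMem (s := Set.Iio c) (by exact not_lt.2 h'.le),
            Set.indicator_of_notMem (fun h'' => absurd h''.2 (not_le.2 h'))]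
    · filter_upwards [ae_restrict_mem measurableSet_Ioc] with t ht
      have := hFm (show -1 ≤ t by linarith [ht.1])
      rwa [hF0 (-1) (by norm_num)] at this
  refine ⟨G.measure, ⟨hprob, hmem, ?_⟩, hφ⟩
  -- The mean is read off from ψ(1) = 1/2.
  have e1 := hφ 1 ⟨zero_le_one, le_rfl⟩
  rw [h1 1 le_rfl] at e1
  have e2 : ∫⁻ x, ENNReal.ofReal (1 - x) ∂G.measure + ∫⁻ x, ENNReal.ofReal x ∂G.measure = 1 := by
    rw [← lintegral_add_left (by fun_prop)]
    calc _ = ∫⁻ _, 1 ∂G.measure := by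
          refine lintegral_congr_ae ?_
          filter_upwards [hmem] with x hx
          rw [← ENNReal.ofReal_add (by linarith [hx.2]) hx.1]
          simp
      _ = 1 := by simp
  have e3 : ENNReal.ofReal (1 - 1 / 2) = 2⁻¹ := by
    rw [show (1 : ℝ) - 1 / 2 = 2⁻¹ by norm_num, ENNReal.ofReal_inv_of_pos two_pos]
    simp
  rw [e1, e3] at e2
  have e4 : ∫⁻ x, ENNReal.ofReal x ∂G.measure = 2⁻¹ := by
    refine (ENNReal.add_right_inj (a := 2⁻¹) (by simp)).1 ?_
    rw [e2, ENNReal.inv_two_add_inv_two]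
  rw [e4, ENNReal.mul_inv_cancel (by simp) (by simp)]

/-- The partial first moment of a law. -/
noncomputable def partialMoment (μ : Measure ℝ) (c : ℝ) : ℝ := ∫ x, max (c - x) 0 ∂μ

variable {μ : Measure ℝ}

lemma IsCenteredLaw.integrable_id (h : IsCenteredLaw μ) : Integrable (fun x : ℝ => x) μ := by
  have := h.prob
  refine Integrable.of_bound (by fun_prop) 1 ?_
  filter_upwards [h.ae_mem] with x hx
  rw [Real.norm_of_nonneg hx.1]
  exact hx.2

lemma IsCenteredLaw.integrable_max (h : IsCenteredLaw μ) (c : ℝ) :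
    Integrable (fun x : ℝ => max (c - x) 0) μ := by
  have := h.prob
  exact ((integrable_const c).sub h.integrable_id).pos_part

lemma IsCenteredLaw.integral_id (h : IsCenteredLaw μ) : ∫ x, x ∂μ = 1 / 2 := by
  have h1 : ENNReal.ofReal (∫ x, x ∂μ) = ∫⁻ x, ENNReal.ofReal x ∂μ :=
    ofReal_integral_eq_lintegral_ofReal h.integrable_id (h.ae_mem.mono fun x hx => hx.1)
  have h2 := h.two_mul_lintegral
  rw [← h1] at h2
  have h3 : 0 ≤ ∫ x, x ∂μ := integral_nonneg_of_ae (h.ae_mem.mono fun x hx => hx.1)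
  have h4 := congrArg ENNReal.toReal h2
  rw [ENNReal.toReal_mul, ENNReal.toReal_ofReal h3] at h4
  simp only [ENNReal.toReal_ofNat, ENNReal.toReal_one] at h4
  linarith

lemma IsCenteredLaw.partialMoment_of_nonpos (h : IsCenteredLaw μ) {c : ℝ} (hc : c ≤ 0) :
    partialMoment μ c = 0 := by
  refine integral_eq_zero_of_ae ?_
  filter_upwards [h.ae_mem] with x hx
  exact max_eq_right (by linarith [hx.1])

lemma IsCenteredLaw.partialMoment_of_one_le (h : IsCenteredLaw μ) {c : ℝ} (hc : 1 ≤ c) :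
    partialMoment μ c = c - 1 / 2 := by
  have := h.prob
  have : partialMoment μ c = ∫ x, (c - x) ∂μ := by
    refine integral_congr_ae ?_
    filter_upwards [h.ae_mem] with x hx
    exact max_eq_left (by linarith [hx.2])
  rw [this, integral_sub (integrable_const c) h.integrable_id, h.integral_id]
  simp

lemma IsCenteredLaw.convexOn_partialMoment (h : IsCenteredLaw μ) :
    ConvexOn ℝ Set.univ (partialMoment μ) := by
  refine ⟨convex_univ, fun c _ d _ a b ha hb hab => ?_⟩
  simp only [partialMoment, smul_eq_mul]
  rw [← integral_const_mul, ← integral_const_mul,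
    ← integral_add ((h.integrable_max c).const_mul a) ((h.integrable_max d).const_mul b)]
  refine integral_mono (h.integrable_max _)
    (((h.integrable_max c).const_mul a).add ((h.integrable_max d).const_mul b)) fun x => ?_
  refine max_le ?_ (by positivity)
  have e : a * c + b * d - x = a * (c - x) + b * (d - x) := by linear_combination x * hab
  rw [e]
  gcongr <;> exact le_max_left _ _

lemma IsCenteredLaw.partialMoment_le (h : IsCenteredLaw μ) (c : ℝ) :
    partialMoment μ c ≤ max c 0 := by
  have := h.prob
  calc partialMoment μ c ≤ ∫ _, max c 0 ∂μ := by
        refine integral_mono_ae (h.integrable_max c) (integrable_const _) ?_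
        filter_upwards [h.ae_mem] with x hx
        exact max_le_max_right _ (by linarith [hx.1])
    _ = max c 0 := by simp

lemma IsCenteredLaw.ofReal_partialMoment (h : IsCenteredLaw μ) (c : ℝ) :
    ENNReal.ofReal (partialMoment μ c) = ∫⁻ x, ENNReal.ofReal (c - x) ∂μ := by
  rw [partialMoment, ofReal_integral_eq_lintegral_ofReal (h.integrable_max c)
    (.of_forall fun x => le_max_right _ _)]
  refine lintegral_congr fun x => ?_
  rw [ENNReal.ofReal_max, ENNReal.ofReal_zero, max_eq_left zero_le]

lemma IsCenteredLaw.hockeyStick_lossOf (h : IsCenteredLaw μ) {c : ℝ}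
    (hc : c ≤ 1) :
    hockeyStick (lossOf ((2 : ℝ≥0∞) • μ) ENNReal.ofReal) (ENNReal.ofReal c)
      (1 - ENNReal.ofReal c) = 2 * ∫⁻ x, ENNReal.ofReal (c - x) ∂μ := by
  have := h.prob
  rw [hockeyStick_lossOf_one_sub _ ENNReal.measurable_ofReal h.ae_le
    (ENNReal.ofReal_le_one.2 hc), lintegral_smul_measure, smul_eq_mul]
  congr 1
  refine lintegral_congr_ae ?_
  filter_upwards [h.ae_mem] with x hx
  rw [ENNReal.ofReal_sub _ hx.1]

/-- A supremum of convex functions is convex, and all partial moments agree outside [0, 1], so the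
supremum has the required asymptotics. -/
lemma exists_isCenteredLaw_iSup {ι : Type*} [Nonempty ι] {μ : ι → Measure ℝ}
    (h : ∀ i, IsCenteredLaw (μ i)) :
    ∃ S : Measure ℝ, IsCenteredLaw S ∧ ∀ c ∈ Set.Icc (0 : ℝ) 1,
      ∫⁻ x, ENNReal.ofReal (c - x) ∂S = ⨆ i, ∫⁻ x, ENNReal.ofReal (c - x) ∂(μ i) := by
  have hbdd : ∀ c, BddAbove (Set.range fun i => partialMoment (μ i) c) := fun c =>
    ⟨max c 0, by rintro _ ⟨i, rfl⟩; exact (h i).partialMoment_le c⟩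
  have hconv : ConvexOn ℝ Set.univ fun c => ⨆ i, partialMoment (μ i) c := by
    refine ⟨convex_univ, fun c _ d _ a b ha hb hab => ciSup_le fun i => ?_⟩
    refine ((h i).convexOn_partialMoment.2 (Set.mem_univ c) (Set.mem_univ d) ha hb hab).trans ?_
    exact add_le_add (mul_le_mul_of_nonneg_left (le_ciSup (hbdd c) i) ha)
      (mul_le_mul_of_nonneg_left (le_ciSup (hbdd d) i) hb)
  obtain ⟨S, hS, hS'⟩ := exists_isCenteredLaw_of_convexOn hconv
    (fun c hc => by simp [(h _).partialMoment_of_nonpos hc])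
    (fun c hc => by simp_rw [(h _).partialMoment_of_one_le hc]; exact ciSup_const)
  refine ⟨S, hS, fun c hc => ?_⟩
  rw [hS' c hc, Monotone.map_ciSup_of_continuousAt ENNReal.continuous_ofReal.continuousAt
    (fun _ _ => ENNReal.ofReal_le_ofReal) (hbdd c)]
  simp_rw [(h _).ofReal_partialMoment]

/-- Nonempty families of privacy loss distributions have pointwise suprema. -/
theorem exists_hockeyStick_eq_iSup {F : Set (Measure EReal)} (hF : ∀ L ∈ F, IsPLD L)
    (hne : F.Nonempty) :
    ∃ S, IsPLD S ∧ ∀ a b : ℝ≥0∞, a ≠ ∞ → b ≠ ∞ →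
      hockeyStick S a b = ⨆ L : F, hockeyStick L.1 a b := by
  have := hne.to_subtype
  choose μ hμ hLμ using fun L : F => (hF L.1 L.2).exists_isCenteredLaw
  obtain ⟨S, hS, hS'⟩ := exists_isCenteredLaw_iSup hμ
  refine ⟨_, hS.isPLD, fun a b ha hb => ?_⟩
  by_cases h0 : a + b = 0
  · simp only [add_eq_zero] at h0
    simp [h0.1, hockeyStick_zero_left]
  have ht : a + b ≠ ∞ := ENNReal.add_ne_top.2 ⟨ha, hb⟩
  -- Homogeneity reduces (a, b) to the line a + b = 1.
  set c := (a / (a + b)).toReal with hc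
  have hcle : a / (a + b) ≤ 1 := ENNReal.div_le_of_le_mul (by rw [one_mul]; exact le_self_add)
  have hctop : a / (a + b) ≠ ∞ := ne_top_of_le_ne_top ENNReal.one_ne_top hcle
  have hofc : ENNReal.ofReal c = a / (a + b) := ENNReal.ofReal_toReal hctop
  have hc1 : c ∈ Set.Icc (0 : ℝ) 1 :=
    ⟨ENNReal.toReal_nonneg, ENNReal.toReal_le_of_le_ofReal zero_le_one (by simpa using hcle)⟩
  have hca : (a + b) * ENNReal.ofReal c = a := by
    rw [hofc, ENNReal.mul_div_cancel h0 ht]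
  have hcb : (a + b) * (1 - ENNReal.ofReal c) = b := by
    rw [ENNReal.mul_sub (fun _ _ => ht), hca, mul_one, ENNReal.add_sub_cancel_left ha]
  have key : ∀ L : Measure EReal, hockeyStick L a b =
      (a + b) * hockeyStick L (ENNReal.ofReal c) (1 - ENNReal.ofReal c) := by
    intro L
    rw [← hockeyStick_mul L ht, hca, hcb]
  simp_rw [key, ← ENNReal.mul_iSup]
  congr 1
  rw [hS.hockeyStick_lossOf hc1.2, hS' c hc1, ENNReal.mul_iSup]
  refine iSup_congr fun L => ?_
  rw [← (hμ L).hockeyStick_lossOf hc1.2, ← hLμ L]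

end Suprema

/-! ### Adaptive composition of two kernels. -/

section Composition

variable {X Y Z : Type*} [MeasurableSpace X] [MeasurableSpace Y] [MeasurableSpace Z]

lemma measure_test_le (P Q : Measure Y) [IsFiniteMeasure P] [IsFiniteMeasure Q] (a b : ℝ≥0∞)
    {A : Set Y} (hA : MeasurableSet A) : a * P A ≤ hockeyStick (pld P Q) a b + b * Q A := by
  have := lintegral_test_le P Q a b (f := A.indicator 1) (measurable_one.indicator hA)
    (Set.indicator_le_self' fun _ _ => zero_le)
  rwa [lintegral_indicator_one hA, lintegral_indicator_one hA] at this

lemma hockeyStick_pld_conv (P Q : Measure Y) [IsProbabilityMeasure P] [IsProbabilityMeasure Q]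
    {S : Measure EReal} (hS : IsLossLaw S) (a b : ℝ≥0∞) :
    hockeyStick ((pld P Q).conv S) a b =
      ∫⁻ y, hockeyStick S a (b * (likelihoodRatio P Q y)⁻¹) ∂P := by
  rw [hockeyStick_conv (isLossLaw_pld P Q) hS, lintegral_pld P Q
    (f := fun t => hockeyStick S a (b * invRatio t)) ((measurable_hockeyStick S a).comp (measurable_const.mul measurable_invRatio))]
  simp only [invRatio_log]

/-- If the second component of an adaptive composition always has a privacy loss dominated by
`S`, then the privacy loss of the composition is dominated by that of the first component
convolved with `S`. -/
lemma hockeyStickLE_compProd (κ κ' : Kernel X Y) [IsMarkovKernel κ] [IsMarkovKernel κ']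
    (η η' : Kernel (X × Y) Z) [IsMarkovKernel η] [IsMarkovKernel η'] (x : X)
    {S : Measure EReal} (hS : IsLossLaw S)
    (h : ∀ y, HockeyStickLE (pld (η (x, y)) (η' (x, y))) S) :
    HockeyStickLE (pld ((κ ⊗ₖ η) x) ((κ' ⊗ₖ η') x)) ((pld (κ x) (κ' x)).conv S) := by
  intro a b ha hb
  -- Each section of this test at a first outcome y tests the second component, with b rescaled by
  -- the inverse likelihood ratio at y.
  set A := optimalTest ((κ ⊗ₖ η) x) ((κ' ⊗ₖ η') x) a b
  have hA : MeasurableSet A := measurableSet_optimalTest _ _ a b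
  have hopt := hockeyStick_add_optimalTest ((κ ⊗ₖ η) x) ((κ' ⊗ₖ η') x) a b
  refine (ENNReal.add_le_add_iff_right
    (ENNReal.mul_ne_top hb (measure_ne_top ((κ' ⊗ₖ η') x) A))).1 ?_
  rw [hopt, hockeyStick_pld_conv _ _ hS, Kernel.compProd_apply hA, Kernel.compProd_apply hA]
  have hm : Measurable fun y => η (x, y) (Prod.mk y ⁻¹' A) :=
    Kernel.measurable_kernel_prodMk_left' hA x
  have hm' : Measurable fun y => η' (x, y) (Prod.mk y ⁻¹' A) :=
    Kernel.measurable_kernel_prodMk_left' hA x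
  have hs := measurable_inv_likelihoodRatio (κ x) (κ' x)
  rw [← lintegral_const_mul _ hm]
  calc ∫⁻ y, a * η (x, y) (Prod.mk y ⁻¹' A) ∂(κ x)
      ≤ ∫⁻ y, (hockeyStick S a (b * (likelihoodRatio (κ x) (κ' x) y)⁻¹) +
          b * ((likelihoodRatio (κ x) (κ' x) y)⁻¹ * η' (x, y) (Prod.mk y ⁻¹' A))) ∂(κ x) := by
        refine lintegral_mono_ae ?_
        filter_upwards [ae_inv_likelihoodRatio_lt_top (κ x) (κ' x)] with y hy
        rw [← mul_assoc]
        exact (measure_test_le _ _ _ _ (measurable_prodMk_left hA)).trans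
          (add_le_add (h y _ _ ha (ENNReal.mul_ne_top hb hy.ne)) le_rfl)
    _ = ∫⁻ y, hockeyStick S a (b * (likelihoodRatio (κ x) (κ' x) y)⁻¹) ∂(κ x) +
          b * ∫⁻ y, (likelihoodRatio (κ x) (κ' x) y)⁻¹ * η' (x, y) (Prod.mk y ⁻¹' A) ∂(κ x) := by
        rw [lintegral_add_right _ (g := fun y => b * ((likelihoodRatio (κ x) (κ' x) y)⁻¹ *
            η' (x, y) (Prod.mk y ⁻¹' A))) (measurable_const.mul (hs.mul hm')),
          lintegral_const_mul b (f := fun y => (likelihoodRatio (κ x) (κ' x) y)⁻¹ *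
            η' (x, y) (Prod.mk y ⁻¹' A)) (hs.mul hm')]
    _ ≤ _ := add_le_add le_rfl
        (mul_le_mul_right (lintegral_inv_likelihoodRatio_mul_le _ _ hm') _)

/-- If the second component of an adaptive composition is selected from a countable family, then
its optimal tests combine to a test of the composition. -/
lemma lintegral_hockeyStick_le_compProd (κ κ' : Kernel X Y) [IsMarkovKernel κ]
    [IsMarkovKernel κ'] (η η' : Kernel (X × Y) Z) [IsMarkovKernel η] [IsMarkovKernel η'] (x : X)
    {n : Y → ℕ} (hn : Measurable n) (hη : ∀ y y', n y = n y' → η (x, y) = η (x, y'))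
    (hη' : ∀ y y', n y = n y' → η' (x, y) = η' (x, y')) (a : ℝ≥0∞) {b : ℝ≥0∞} (hb : b ≠ ∞) :
    ∫⁻ y, hockeyStick (pld (η (x, y)) (η' (x, y))) a
        (b * (likelihoodRatio (κ x) (κ' x) y)⁻¹) ∂(κ x) ≤
      hockeyStick (pld ((κ ⊗ₖ η) x) ((κ' ⊗ₖ η') x)) a b := by
  have hne : Nonempty Y := (κ x).nonempty_of_neZero
  set s : Y → ℝ≥0∞ := fun y => (likelihoodRatio (κ x) (κ' x) y)⁻¹ with hs
  have hsm : Measurable s := measurable_inv_likelihoodRatio _ _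
  set N : Set Y := {y | (κ x).rnDeriv (κ x + κ' x) y ≠ 0} with hN
  have hNm : MeasurableSet N := measurableSet_rnDeriv_ne_zero _ _
  -- One representative outcome per class: only countably many second components occur, so the glued
  -- test is measurable.
  set r : ℕ → Y := Function.invFun n with hr
  have hrn : ∀ y, n (r (n y)) = n y := fun y => Function.invFun_eq ⟨y, rfl⟩
  -- Sections off `N` are empty, so that integrals against κ' x can be rewritten against κ x.
  set A : Set (Y × Z) :=
    {p | p.1 ∈ N ∧ p.2 ∈ optimalTest (η (x, p.1)) (η' (x, p.1)) a (b * s p.1)} with hAdef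
  have hA : MeasurableSet A := by
    have : A = ⋃ k : ℕ, {p | p.1 ∈ N ∧ n p.1 = k ∧
        b * s p.1 * (likelihoodRatio (η (x, r k)) (η' (x, r k)) p.2)⁻¹ < a ∧
        (η (x, r k)).rnDeriv (η (x, r k) + η' (x, r k)) p.2 ≠ 0} := by
      ext ⟨y, z⟩
      simp only [hAdef, optimalTest, Set.mem_iUnion]
      constructor
      · rintro ⟨h1, h2, h3⟩
        refine ⟨n y, h1, rfl, ?_⟩
        rw [hη _ _ (hrn y), hη' _ _ (hrn y)]
        exact ⟨h2, h3⟩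
      · rintro ⟨k, h1, rfl, h⟩
        rw [hη _ _ (hrn y), hη' _ _ (hrn y)] at h
        exact ⟨h1, h⟩
    rw [this]
    refine MeasurableSet.iUnion fun k => ?_
    refine (measurable_fst hNm).inter (MeasurableSet.inter ?_ (MeasurableSet.inter ?_ ?_))
    · exact (hn.comp measurable_fst) (measurableSet_singleton k)
    · exact measurableSet_lt ((measurable_const.mul (hsm.comp measurable_fst)).mul
        ((measurable_inv_likelihoodRatio _ _).comp measurable_snd)) measurable_const
    · exact measurable_snd (measurableSet_rnDeriv_ne_zero _ _)
  have hm : Measurable fun y => η (x, y) (Prod.mk y ⁻¹' A) :=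
    Kernel.measurable_kernel_prodMk_left' hA x
  have hm' : Measurable fun y => η' (x, y) (Prod.mk y ⁻¹' A) :=
    Kernel.measurable_kernel_prodMk_left' hA x
  have hsec : ∀ y ∈ N, Prod.mk y ⁻¹' A = optimalTest (η (x, y)) (η' (x, y)) a (b * s y) := by
    intro y hy
    ext z
    exact ⟨fun h => h.2, fun h => ⟨hy, h⟩⟩
  have hsec' : ∀ y ∉ N, Prod.mk y ⁻¹' A = ∅ := by
    intro y hy
    ext z
    exact ⟨fun h => hy h.1, fun h => h.elim⟩
  have htest := measure_test_le ((κ ⊗ₖ η) x) ((κ' ⊗ₖ η') x) a b hA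
  refine (ENNReal.add_le_add_iff_right
    (ENNReal.mul_ne_top hb (measure_ne_top ((κ' ⊗ₖ η') x) A))).1 (le_trans (le_of_eq ?_) htest)
  rw [Kernel.compProd_apply hA, Kernel.compProd_apply hA, ← lintegral_const_mul _ hm]
  have hQ : ∫⁻ y, η' (x, y) (Prod.mk y ⁻¹' A) ∂(κ' x) =
      ∫⁻ y, s y * η' (x, y) (Prod.mk y ⁻¹' A) ∂(κ x) := by
    rw [lintegral_inv_likelihoodRatio_mul _ _ hm', ← lintegral_indicator hNm]
    refine lintegral_congr fun y => ?_
    by_cases hy : y ∈ N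
    · rw [Set.indicator_of_mem hy]
    · rw [Set.indicator_of_notMem hy, hsec' y hy, measure_empty]
  rw [hQ, ← lintegral_const_mul b (f := fun y => s y * η' (x, y) (Prod.mk y ⁻¹' A))
    (hsm.mul hm'), ← lintegral_add_right _
    (g := fun y => b * (s y * η' (x, y) (Prod.mk y ⁻¹' A))) (measurable_const.mul (hsm.mul hm'))]
  refine lintegral_congr_ae ?_
  filter_upwards [ae_rnDeriv_ne_zero (κ x) (κ' x)] with y hy
  rw [hsec y hy, ← hockeyStick_add_optimalTest, mul_assoc]

lemma hockeyStickLE_pld_self (P : Measure Y) [IsProbabilityMeasure P] :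
    HockeyStickLE (pld P P) pldId := by
  intro a b ha hb
  have h := hockeyStick_add_optimalTest P P a b
  rw [hockeyStick_pldId, ENNReal.eq_sub_of_add_eq
    (ENNReal.mul_ne_top hb (measure_ne_top P _)) h,
    ← ENNReal.sub_mul (fun _ _ => measure_ne_top P _)]
  exact mul_le_of_le_one_right' prob_le_one

end Composition

/-! ### Sufficiency: commutation with suprema makes the filter free. -/

section Mechanism

variable {𝒟 : Type v}

namespace AdaptiveMechanism

instance isMarkovKernel_law (D : 𝒟) {k : ℕ} {X : Type u} [MeasurableSpace X]
    (M : AdaptiveMechanism.{u, v} 𝒟 k X) : IsMarkovKernel (M.law D) := by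
  induction M with
  | nil => exact inferInstanceAs (IsMarkovKernel (Kernel.const _ (Measure.dirac PUnit.unit)))
  | cons Y κ hκ next ih =>
    have := hκ D
    exact inferInstanceAs (IsMarkovKernel (κ D ⊗ₖ next.law D))

end AdaptiveMechanism

lemma isLossLaw_convList_of_subset {F : Set (Measure EReal)} (hF : ∀ L ∈ F, IsPLD L)
    {Ls : List (Measure EReal)} (h : ∀ L ∈ Ls, L ∈ F) : IsLossLaw (convList Ls) :=
  isLossLaw_convList fun L hL => (hF L (h L hL)).isLossLaw

lemma ConvCommutesSup.mono {F : Set (Measure EReal)} {j k : ℕ} (hjk : j ≤ k)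
    (h : ConvCommutesSup F k) : ConvCommutesSup F j := fun L hL F' hF' hne =>
  h L hL F' (fun _ hN => by
    obtain ⟨Ls, h1, h2⟩ := hF' hN
    exact ⟨Ls, h1.trans_le hjk, h2⟩) hne

/-- The induction needs a target `S` other than `B`: any PLD dominating all continuations that the
filter still admits after the given history. For the tail, the target is the supremum `T` of the
continuations admissible after `L`. It serves all outcomes y at once, because the extended history
does not depend on y. -/
lemma hockeyStickLE_law_of_obeys {D₁ D₂ : 𝒟} {F : Set (Measure EReal)}
    {B : Measure EReal} {k : ℕ} {X : Type u} [MeasurableSpace X]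
    (M : AdaptiveMechanism.{u, v} 𝒟 k X) (hcomm : ConvCommutesSup F k)
    (hist : X → List (Measure EReal)) (hM : M.Obeys D₁ D₂ (filterRule F B) hist) (x : X)
    {S : Measure EReal} (hS : IsPLD S)
    (h : ∀ Ls : List (Measure EReal), Ls.length ≤ k → (∀ L ∈ Ls, L ∈ F) →
      PLDLE (convList (hist x ++ Ls)) B → PLDLE (convList Ls) S) :
    HockeyStickLE (pld (M.law D₁ x) (M.law D₂ x)) S := by
  induction M generalizing S with
  | nil =>
    exact (hockeyStickLE_pld_self (Measure.dirac PUnit.unit)).trans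
      (pldId_hockeyStickLE hS.isLossLaw)
  | @cons k X _ Y _ κ hκ next ih =>
    obtain ⟨hfirst, hnext⟩ := hM
    have := hκ D₁
    have := hκ D₂
    set L := pld (κ D₁ x) (κ D₂ x) with hL
    obtain ⟨hLF, hLB⟩ := hfirst x
    set F' : Set (Measure EReal) := {N | ∃ Ls : List (Measure EReal), Ls.length ≤ k ∧
      (∀ L' ∈ Ls, L' ∈ F) ∧ PLDLE (convList ((hist x ++ [L]) ++ Ls)) B ∧ N = convList Ls}
    -- With one of k + 1 queries spent on `L`, at most k remain, which is the strict bound in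
    -- `convPowLT F (k + 1)`.
    have hF' : F' ⊆ convPowLT F (k + 1) := by
      rintro N ⟨Ls, h1, h2, -, h4⟩
      exact ⟨Ls, Nat.lt_succ_of_le h1, h2, h4⟩
    -- Stopping is admissible because the filter accepted `L`.
    have hne : F'.Nonempty := ⟨convList [], [], by simp, by simp, by simpa using hLB, rfl⟩
    obtain ⟨T, ⟨hT, hTub, -⟩, -, -, hTlub⟩ := hcomm L hLF F' hF' hne
    have hrest : ∀ y, HockeyStickLE (pld (next.law D₁ (x, y)) (next.law D₂ (x, y))) T := by
      intro y
      refine ih (hcomm.mono (Nat.le_succ k)) _ hnext (x, y) hT fun Ls h1 h2 h3 => ?_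
      exact hTub _ ⟨Ls, h1, h2, h3, rfl⟩
    refine (hockeyStickLE_compProd (κ D₁) (κ D₂) (next.law D₁) (next.law D₂) x hT.isLossLaw
      hrest).trans (hTlub S hS ?_).hockeyStickLE
    rintro _ ⟨_, ⟨Ls, h1, h2, h3, rfl⟩, rfl⟩
    rw [← convList_cons]
    refine h (L :: Ls) (by simpa using h1) ?_ (by simpa using h3)
    simpa using ⟨hLF, h2⟩

theorem ConvCommutesSup.filterFree {D₁ D₂ : 𝒟} {F : Set (Measure EReal)}
    {B : Measure EReal} (hB : IsPLD B) {k : ℕ}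
    (hcomm : ConvCommutesSup F k) : FilterFree.{u, v} D₁ D₂ F B k := fun M hM =>
  (hockeyStickLE_law_of_obeys M hcomm _ hM PUnit.unit hB fun _ _ _ h => h).pldLE
    (isPLD_pld _ _) hB

/-! ### Necessity: adversaries that choose their continuation by the observed loss. -/

lemma IsPLD.exists_pair {L : Measure EReal} (h : IsPLD L) :
    ∃ P Q : Measure (ULift.{u} ℝ), IsProbabilityMeasure P ∧ IsProbabilityMeasure Q ∧
      pld P Q = L := by
  obtain ⟨μ, hμ, rfl⟩ := h.exists_isCenteredLaw
  have := hμ.prob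
  have hup : Measurable (ULift.up : ℝ → ULift.{u} ℝ) := measurable_up
  have hq : Measurable fun y : ULift.{u} ℝ => ENNReal.ofReal y.down :=
    ENNReal.measurable_ofReal.comp measurable_down
  have hmass : ∀ f : ULift.{u} ℝ → ℝ≥0∞, Measurable f →
      ((((2 : ℝ≥0∞) • μ).map ULift.up).withDensity f) Set.univ =
        (((2 : ℝ≥0∞) • μ).withDensity (f ∘ ULift.up)) Set.univ := by
    intro f hf
    rw [withDensity_apply _ MeasurableSet.univ, withDensity_apply _ MeasurableSet.univ,
      setLIntegral_univ, setLIntegral_univ, lintegral_map hf hup]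
    rfl
  obtain ⟨hP, hQ⟩ := hμ.isProbabilityMeasure_withDensity
  refine ⟨_, _, ⟨(hmass _ (measurable_const.sub hq)).trans hP.measure_univ⟩,
    ⟨(hmass _ hq).trans hQ.measure_univ⟩, ?_⟩
  refine lossOf_map _ hup hq ?_
  refine (ae_map_iff hup.aemeasurable (measurableSet_le hq measurable_const)).2 ?_
  exact hμ.ae_le

open Classical in
/-- Adaptive mechanisms that play one of countably many sequences of privacy loss distributions,
selected by the past outcome. -/
lemma exists_selection_mechanism {D₁ D₂ : 𝒟} (hD : D₁ ≠ D₂) (j : ℕ)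
    {ℓ : ℕ → List (Measure EReal)} (hlen : ∀ n, (ℓ n).length = j)
    (hℓ : ∀ n, ∀ L ∈ ℓ n, IsPLD L) {X : Type u} [MeasurableSpace X] {sel : X → ℕ}
    (hsel : Measurable sel) :
    ∃ M : AdaptiveMechanism.{u, v} 𝒟 j X,
      (∀ Γ hist, (∀ x l₁ L l₂, ℓ (sel x) = l₁ ++ L :: l₂ → L ∈ Γ (hist x ++ l₁)) →
        M.Obeys D₁ D₂ Γ hist) ∧
      (∀ D x x', sel x = sel x' → M.law D x = M.law D x') ∧
      ∀ x, HockeyStickLE (convList (ℓ (sel x))) (pld (M.law D₁ x) (M.law D₂ x)) := by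
  induction j generalizing ℓ X with
  | zero =>
    refine ⟨.nil, fun _ _ _ => trivial, fun _ _ _ _ => rfl, fun x => ?_⟩
    rw [List.length_eq_zero_iff.1 (hlen (sel x))]
    exact pldId_hockeyStickLE (isLossLaw_pld _ _)
  | succ j ih =>
    choose hd tl hht using fun n => List.exists_of_length_succ _ (hlen n)
    have hhd : ∀ n, IsPLD (hd n) := fun n => hℓ n _ (by simp [hht n])
    have htl : ∀ n, ∀ L ∈ tl n, IsPLD L := fun n L hL => hℓ n _ (by simp [hht n, hL])
    choose P Q hP hQ hPQ using fun n => (hhd n).exists_pair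
    set κ : 𝒟 → Kernel X (ULift.{u} ℝ) := fun D =>
      (Kernel.ofFunOfCountable (if D = D₁ then P else Q)).comap sel hsel with hκdef
    have hκ₁ : ∀ x, κ D₁ x = P (sel x) := fun x => by
      simp [hκdef, Kernel.comap_apply, Kernel.ofFunOfCountable]
    have hκ₂ : ∀ x, κ D₂ x = Q (sel x) := fun x => by
      simp [hκdef, Kernel.comap_apply, Kernel.ofFunOfCountable, hD.symm]
    have hκsel : ∀ D x x', sel x = sel x' → κ D x = κ D x' := fun D x x' h => by
      simp [hκdef, Kernel.comap_apply, h]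
    have hκ : ∀ D, IsMarkovKernel (κ D) := fun D => ⟨fun x => by
      by_cases h : D = D₁
      · rw [h, hκ₁]; exact hP _
      · have : κ D x = Q (sel x) := by simp [hκdef, Kernel.comap_apply, Kernel.ofFunOfCountable, h]
        rw [this]; exact hQ _⟩
    have hpld : ∀ x, pld (κ D₁ x) (κ D₂ x) = hd (sel x) := fun x => by rw [hκ₁, hκ₂, hPQ]
    obtain ⟨next, h1, h2, h3⟩ := ih (ℓ := tl)
      (fun n => by have := hlen n; rw [hht n] at this; simpa using this) htl
      (X := X × ULift.{u} ℝ) (hsel.comp measurable_fst)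
    refine ⟨.cons _ κ hκ next, fun Γ hist hΓ => ⟨fun x => ?_, ?_⟩, fun D x x' hx => ?_,
      fun x => ?_⟩
    · have := hΓ x [] (hd (sel x)) (tl (sel x)) (hht _)
      rwa [List.append_nil, ← hpld] at this
    · refine h1 Γ _ fun p l₁ L l₂ hp => ?_
      rw [hpld, List.append_assoc]
      exact hΓ p.1 (hd (sel p.1) :: l₁) L l₂ (by rw [hht]; exact congrArg _ hp)
    · have := hκ D
      refine Measure.ext fun A hA => ?_
      refine (Kernel.compProd_apply hA (κ D) (next.law D) x).trans
        (Eq.trans ?_ (Kernel.compProd_apply hA (κ D) (next.law D) x').symm)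
      rw [hκsel D x x' hx]
      refine lintegral_congr fun y => ?_
      rw [h2 D (x, y) (x', y) hx]
    · intro a b ha hb
      have := hκ D₁
      have := hκ D₂
      rw [hht, convList_cons, ← hpld, hockeyStick_pld_conv _ _
        (isLossLaw_convList fun L hL => (htl _ L hL).isLossLaw)]
      -- Once `x` has fixed the sequence, the remainder ignores the new outcome, so a constant
      -- selector suffices.
      refine le_trans (lintegral_mono_ae ?_) (lintegral_hockeyStick_le_compProd (κ D₁) (κ D₂)
        (next.law D₁) (next.law D₂) x (n := fun _ => 0) measurable_const
        (fun y y' _ => h2 D₁ (x, y) (x, y') rfl) (fun y y' _ => h2 D₂ (x, y) (x, y') rfl) a hb)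
      filter_upwards [ae_inv_likelihoodRatio_lt_top (κ D₁ x) (κ D₂ x)] with y hy
      exact h3 (x, y) _ _ ha (ENNReal.mul_ne_top hb hy.ne)

lemma convList_replicate_pldId (n : ℕ) : convList (List.replicate n pldId) = pldId := by
  have : SFinite pldId := inferInstanceAs (SFinite (Measure.dirac 0))
  induction n with
  | zero => rfl
  | succ n ih =>
    rw [List.replicate_succ, convList_cons, ih]
    exact Measure.conv_dirac_zero _

lemma convList_append_replicate_pldId (Ls : List (Measure EReal)) (n : ℕ) :
    convList (Ls ++ List.replicate n pldId) = convList Ls := by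
  induction Ls with
  | nil => exact convList_replicate_pldId n
  | cons L Ls ih => rw [List.cons_append, convList_cons, convList_cons, ih]

/-- A mechanism that first plays `L` and then a nearly optimal continuation shows that a budget
dominating all continuations dominates `L` convolved with their supremum. -/
lemma hockeyStickLE_conv_of_filterFree {D₁ D₂ : 𝒟} (hD : D₁ ≠ D₂) {F : Set (Measure EReal)}
    (hF : ∀ L ∈ F, IsPLD L) (hId : pldId ∈ F) {k : ℕ} (hk : 0 < k) {U : Measure EReal}
    (hU : IsPLD U) (hfree : FilterFree.{u, v} D₁ D₂ F U k) {L : Measure EReal} (hL : L ∈ F)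
    {F' : Set (Measure EReal)} (hF' : F' ⊆ convPowLT F k) (hne : F'.Nonempty)
    (hUF : ∀ L' ∈ F', HockeyStickLE (L.conv L') U) {S : Measure EReal} (hS : IsPLD S)
    (hSsup : ∀ a b : ℝ≥0∞, a ≠ ∞ → b ≠ ∞ →
      hockeyStick S a b = ⨆ L' : F', hockeyStick L'.1 a b) :
    HockeyStickLE (L.conv S) U := by
  obtain ⟨j, rfl⟩ : ∃ j, k = j + 1 := ⟨k - 1, by omega⟩
  intro a b ha hb
  refine ENNReal.le_of_forall_pos_le_add fun δ hδ _ => ?_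
  -- Half of the error pays for near-optimality of the continuation, half for rounding b e^{-s} to
  -- the grid of multiples of `ε`.
  set ε : ℝ≥0∞ := (δ : ℝ≥0∞) / 2 with hε
  have hε0 : ε ≠ 0 := by simp [hε, hδ.ne']
  have hεtop : ε ≠ ∞ := (ENNReal.div_lt_top ENNReal.coe_ne_top (by simp)).ne
  have hεε : ε + ε = δ := ENNReal.add_halves _
  have hnear : ∀ n : ℕ, ∃ L' ∈ F',
      hockeyStick S a (n * ε) ≤ hockeyStick L' a (n * ε) + ε := by
    intro n
    have hfin : hockeyStick S a (n * ε) ≠ ∞ :=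
      ne_top_of_le_ne_top ha (hockeyStick_le_self hS.isLossLaw _ _)
    by_cases h0 : hockeyStick S a (n * ε) = 0
    · obtain ⟨L', hL'⟩ := hne
      exact ⟨L', hL', by simp [h0]⟩
    · have hlt := ENNReal.sub_lt_self hfin h0 hε0
      conv_rhs at hlt => rw [hSsup _ _ ha (ENNReal.mul_ne_top (by simp) hεtop)]
      obtain ⟨L', hL'⟩ := lt_iSup_iff.1 hlt
      exact ⟨L'.1, L'.2, tsub_le_iff_right.1 hL'.le⟩
  choose N hN hNnear using hnear
  choose ℓ₀ hlen₀ hℓ₀ hNℓ using fun n => hF' (hN n)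
  -- Padding with `Id` gives all continuations the length j left after `L`.
  set ℓ : ℕ → List (Measure EReal) := fun n =>
    ℓ₀ n ++ List.replicate (j - (ℓ₀ n).length) pldId with hℓdef
  have hlen : ∀ n, (ℓ n).length = j := fun n => by
    have := hlen₀ n
    simp only [hℓdef, List.length_append, List.length_replicate]
    omega
  have hℓF : ∀ n, ∀ L' ∈ ℓ n, L' ∈ F := by
    intro n L' hL'
    rcases List.mem_append.1 hL' with h | h
    · exact hℓ₀ n L' h
    · rw [List.eq_of_mem_replicate h]; exact hId
  have hconvℓ : ∀ n, convList (ℓ n) = N n := fun n => by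
    rw [hNℓ n]; exact convList_append_replicate_pldId _ _
  have hprefix : ∀ n l₁ l₂, ℓ n = l₁ ++ l₂ → PLDLE (convList (L :: l₁)) U := by
    intro n l₁ l₂ h
    have hl : ∀ L' ∈ l₁ ++ l₂, L' ∈ F := fun L' hL' => hℓF n L' (h ▸ hL')
    have hl₁ : ∀ L' ∈ L :: l₁, IsLossLaw L' := by
      intro L' hL'
      rcases List.mem_cons.1 hL' with rfl | h'
      · exact (hF _ hL).isLossLaw
      · exact (hF _ (hl _ (List.mem_append_left _ h'))).isLossLaw
    refine HockeyStickLE.pldLE (isLossLaw_convList hl₁).isPLD hU ?_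
    refine (convList_hockeyStickLE_append hl₁ (Ls' := l₂) fun L' hL' =>
      (hF _ (hl _ (List.mem_append_right _ hL'))).isLossLaw).trans ?_
    rw [List.cons_append, ← h, convList_cons, hconvℓ]
    exact hUF _ (hN n)
  obtain ⟨P, Q, hP, hQ, hPQ⟩ := (hF L hL).exists_pair.{u}
  set s : ULift.{u} ℝ → ℝ≥0∞ := fun y => (likelihoodRatio P Q y)⁻¹ with hs
  have hsm : Measurable s := measurable_inv_likelihoodRatio _ _
  -- The grid cell of b e^{-s}; the default value at ∞ matters only on a null set.
  set n : ULift.{u} ℝ → ℕ := fun y => ⌊(b * s y / ε).toNNReal⌋₊ with hn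
  have hnm : Measurable n :=
    Nat.measurable_floor.comp ((measurable_const.mul hsm).div_const ε).ennreal_toNNReal
  classical
  set κ : 𝒟 → Kernel PUnit.{u + 1} (ULift.{u} ℝ) := fun D =>
    Kernel.const _ (if D = D₁ then P else Q) with hκdef
  have hκ₁ : ∀ x, κ D₁ x = P := fun x => by simp [hκdef]
  have hκ₂ : ∀ x, κ D₂ x = Q := fun x => by simp [hκdef, hD.symm]
  have hκ : ∀ D, IsMarkovKernel (κ D) := fun D => ⟨fun x => by
    by_cases h : D = D₁
    · rw [h, hκ₁]; exact hP
    · have : κ D x = Q := by simp [hκdef, h]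
      rw [this]; exact hQ⟩
  have := hκ D₁
  have := hκ D₂
  obtain ⟨next, h1, h2, h3⟩ := exists_selection_mechanism.{u, v} hD j hlen
    (fun m L' hL' => hF _ (hℓF m L' hL')) (X := PUnit.{u + 1} × ULift.{u} ℝ)
    (hnm.comp measurable_snd)
  have hobeys : (AdaptiveMechanism.cons _ κ hκ next).Obeys D₁ D₂ (filterRule F U)
      (fun _ => []) := by
    refine ⟨fun x => ?_, h1 _ _ fun p l₁ L' l₂ hp => ?_⟩
    · rw [hκ₁, hκ₂, hPQ]
      exact ⟨hL, hprefix 0 [] _ rfl⟩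
    · rw [hκ₁, hκ₂, hPQ]
      refine ⟨hℓF _ L' (by rw [show ℓ _ = _ from hp]; simp), ?_⟩
      exact hprefix _ (l₁ ++ [L']) l₂ (by simpa using hp)
  have hle := (hfree _ hobeys).hockeyStickLE a b ha hb
  have hlow := lintegral_hockeyStick_le_compProd (κ D₁) (κ D₂) (next.law D₁) (next.law D₂)
    PUnit.unit hnm (fun y y' h => h2 D₁ (_, y) (_, y') h) (fun y y' h => h2 D₂ (_, y) (_, y') h)
    a hb
  refine le_trans ?_ (add_le_add (hlow.trans hle) le_rfl)
  rw [← hPQ, hockeyStick_pld_conv _ _ hS.isLossLaw]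
  calc ∫⁻ y, hockeyStick S a (b * (likelihoodRatio P Q y)⁻¹) ∂P
      ≤ ∫⁻ y, (hockeyStick (pld (next.law D₁ (PUnit.unit, y)) (next.law D₂ (PUnit.unit, y))) a
          (b * s y) + δ) ∂P := by
        refine lintegral_mono_ae ?_
        filter_upwards [ae_inv_likelihoodRatio_lt_top P Q] with y hy
        have hbs : b * s y ≠ ∞ := ENNReal.mul_ne_top hb hy.ne
        have hdiv : b * s y / ε ≠ ∞ := (ENNReal.div_lt_top hbs hε0).ne
        have hmul : b * s y / ε * ε = b * s y := ENNReal.div_mul_cancel hε0 hεtop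
        have hfl : (n y : ℝ≥0∞) ≤ b * s y / ε := by
          rw [← ENNReal.coe_toNNReal hdiv, ← ENNReal.coe_natCast, ENNReal.coe_le_coe]
          exact Nat.floor_le zero_le
        have hfl' : b * s y / ε ≤ n y + 1 := by
          rw [← ENNReal.coe_toNNReal hdiv]
          exact_mod_cast (Nat.lt_floor_add_one (b * s y / ε).toNNReal).le
        have hlo : n y * ε ≤ b * s y := hmul ▸ mul_le_mul_left hfl ε
        have hhi : b * s y ≤ n y * ε + ε := by
          have := mul_le_mul_left hfl' ε
          rwa [hmul, add_mul, one_mul] at this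
        have hNy : IsLossLaw (N (n y)) := by
          rw [← hconvℓ]; exact isLossLaw_convList_of_subset hF (hℓF _)
        calc hockeyStick S a (b * s y) ≤ hockeyStick S a (n y * ε) := hockeyStick_anti _ _ hlo
          _ ≤ hockeyStick (N (n y)) a (n y * ε) + ε := hNnear _
          _ ≤ hockeyStick (N (n y)) a (b * s y) + ε + ε :=
            add_le_add (hockeyStick_le_add hNy a hhi) le_rfl
          _ ≤ _ := by
            rw [add_assoc, hεε, ← hconvℓ]
            exact add_le_add (h3 (_, y) _ _ ha hbs) le_rfl
    _ = _ := by
        rw [lintegral_add_right _ measurable_const, lintegral_const, measure_univ, mul_one,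
          hκ₁, hκ₂]

/-- The supremum `S` exists, and L ⊕ S is an upper bound, without any appeal to freeness. Freeness
enters only for leastness, with the competing upper bound `U` as budget. -/
theorem convCommutesSup_of_filterFree {D₁ D₂ : 𝒟} (hD : D₁ ≠ D₂) {F : Set (Measure EReal)}
    (hF : ∀ L ∈ F, IsPLD L) (hId : pldId ∈ F) {k : ℕ} (hk : 0 < k)
    (hfree : ∀ B, IsPLD B → FilterFree.{u, v} D₁ D₂ F B k) : ConvCommutesSup F k := by
  intro L hL F' hF' hne
  have hPLD : ∀ L' ∈ F', IsPLD L' := by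
    intro L' hL'
    obtain ⟨Ls, -, h, rfl⟩ := hF' hL'
    exact (isLossLaw_convList_of_subset hF h).isPLD
  have hLL := (hF L hL).isLossLaw
  obtain ⟨S, hS, hSsup⟩ := exists_hockeyStick_eq_iSup hPLD hne
  have hub : ∀ L' ∈ F', HockeyStickLE L' S := fun L' hL' a b ha hb => by
    rw [hSsup a b ha hb]
    exact le_iSup (fun L : F' => hockeyStick L.1 a b) ⟨L', hL'⟩
  refine ⟨S, ⟨hS, fun L' hL' => (hub L' hL').pldLE (hPLD L' hL') hS, fun U hU h => ?_⟩,
    (hLL.conv hS.isLossLaw).isPLD, ?_, fun U hU h => ?_⟩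
  · refine HockeyStickLE.pldLE hS hU fun a b ha hb => ?_
    rw [hSsup a b ha hb]
    exact iSup_le fun L' => (h L'.1 L'.2).hockeyStickLE a b ha hb
  · rintro _ ⟨L', hL', rfl⟩
    have hL'' := (hPLD L' hL').isLossLaw
    exact (HockeyStickLE.conv_left hLL hL'' hS.isLossLaw (hub L' hL')).pldLE
      (hLL.conv hL'').isPLD (hLL.conv hS.isLossLaw).isPLD
  · exact (hockeyStickLE_conv_of_filterFree hD hF hId hk hU (hfree U hU) hL hF' hne
      (fun L' hL' => (h _ ⟨L', hL', rfl⟩).hockeyStickLE) hS hSsup).pldLE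
      (hLL.conv hS.isLossLaw).isPLD hU

end Mechanism

end PrivacyLoss

theorem mainTheorem2 {𝒟 : Type v} (D₁ D₂ : 𝒟) (hD : D₁ ≠ D₂)
    (F : Set (Measure EReal)) (hF : ∀ L ∈ F, IsPLD L)
    (hId : pldId ∈ F) :
    (∀ k : ℕ, 0 < k →
      ((∀ B, IsPLD B → FilterFree.{u, v} D₁ D₂ F B k) ↔
        ConvCommutesSup F k)) ∧
    ((∀ B, IsPLD B → ∀ k : ℕ, 0 < k →
        FilterFree.{u, v} D₁ D₂ F B k) ↔
      ∀ k : ℕ, 0 < k → ConvCommutesSup F k) := by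
  have key : ∀ k : ℕ, 0 < k →
      ((∀ B, IsPLD B → FilterFree.{u, v} D₁ D₂ F B k) ↔ ConvCommutesSup F k) := fun k hk =>
    ⟨convCommutesSup_of_filterFree hD hF hId hk, fun h B hB => h.filterFree hB⟩
  exact ⟨key, fun h k hk => (key k hk).1 fun B hB => h B hB k hk,
    fun h B hB k hk => (key k hk).2 (h k hk) B hB⟩
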